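/- **Theorem.** Let $X$ be a Markov chain on a finite set $V$ with transition probabilities $p_{uv}$ and stationary distribution $\pi$. Its graph $G_X$ has vertex set $V$ and an edge $\{u,v\}$ whenever $u\ne v$ and $p_{uv}>0$ or $p_{vu}>0$. The chain is *lazy* if $p_{vv}=1/2$ for all $v$, *reversible* if $\pi(u)p_{uv}=\pi(v)p_{vu}$ for all $u,v$, and *$\varepsilon$-uniform* if $\varepsilon\,\pi(x)p_{xy}\le \pi(u)p_{uv}\le \pi(x)p_{xy}/\varepsilon$ for all edges $\{u,v\},\{x,y\}$ of $G_X$ (each taken in either direction). Put $$t_{\rm mix}(X)=\min\Bigl\{n\ge 0:\ \max_{v\in V}\max_{A\subset V}|\mathbb P_v(X_n\in A)-\pi(A)|\le \tfrac14\Bigr\},$$ $$t_{\rm stop}(X)=\max_{v\in V}\ \inf\bigl\{\mathbb E_v[\tau]:\ \tau \text{ is a stopping rule with } \mathbb P_v(X_\tau=u)=\pi(u)\text{ for all }u\in V\bigr\},$$ where a stopping rule is a stopping time that may use extra randomness: at each time it decides to stop with a probability that depends on the trajectory of the chain so far. Connected graphs $G=(V,E)$ and $G'=(V',E')$ with graph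 distances $d,d'$ are *$r$-roughly isometric* if there is a relation $\mathcal C\subset V\times V'$ in which every element of $V$ and every element of $V'$ occurs, such that $$\frac{\max(d(v,w),d'(v',w'))+1}{\min(d(v,w),d'(v',w'))+1}\le r\qquad\text{for all }(v,v'),(w,w')\in\mathcal C .$$ Then for every $\Delta\in\mathbb N$, $\varepsilon>0$ and $r\in\mathbb R$ there is a constant $C<\infty$, depending only on $\Delta,\varepsilon,r$, with the following property. Let $X$ and $Y$ be irreducible lazy $\varepsilon$-uniform Markov chains on finite state spaces, such that $T=G_Y$ is a tree, $G=G_X$ and $T$ have maximum degree at most $\Delta$, and $G$ and $T$ are $r$-roughly isometric. Then $$t_{\rm stop}(X)\le C\,t_{\rm stop}(Y)\quad\text{and}\quad t_{\rm stop}(Y)\le C\,t_{\rm stop}(X).$$ If moreover $X$ and $Y$ are both reversible, then $$t_{\rm mix}(X)\le C\,t_{\rm mix}(Y)\quad\text{and}\quad t_{\rm mix}(Y)\le C\,t_{\rm mix}(X).$$ -/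

import Mathlib

open scoped ENNReal NNReal

universe u v

noncomputable section

namespace MarkovRI

/-- The (undirected, loopless) graph of a chain with transition matrix `P`: the vertices `x ≠ y`
are adjacent when `P x y > 0` or `P y x > 0`. -/
def chainGraph {V : Type u} (P : Matrix V V ℝ) : SimpleGraph V :=
  SimpleGraph.fromRel fun x y => 0 < P x y

/-- `π` is a stationary probability distribution of the transition matrix `P`. -/
structure IsStationary {V : Type u} [Fintype V] (P : Matrix V V ℝ) (π : V → ℝ) : Prop where
  nonneg : ∀ x, 0 ≤ π x
  sum_eq_one : ∑ x, π x = 1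
  stationary : ∀ y, ∑ x, π x * P x y = π y

/-- `P` is the transition matrix of an irreducible lazy Markov chain on the finite state space `V`,
and `π` is its stationary distribution. -/
structure IsLazyIrreducibleChain {V : Type u} [Fintype V] [DecidableEq V]
    (P : Matrix V V ℝ) (π : V → ℝ) : Prop where
  stochastic : P ∈ Matrix.rowStochastic ℝ V
  irreducible : P.IsIrreducible
  lazy : ∀ x, P x x = 1 / 2
  stationary : IsStationary P π

/-- The chain is `ε`-uniform: the stationary flows along any two edges of its graph, each taken in
either direction, are within a factor `ε` of each other. -/
def IsUniform {V : Type u} (ε : ℝ) (P : Matrix V V ℝ) (π : V → ℝ) : Prop :=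
  ∀ x y a b : V, (chainGraph P).Adj x y → (chainGraph P).Adj a b →
    ε * (π x * P x y) ≤ π a * P a b ∧ π a * P a b ≤ π x * P x y / ε

/-- Detailed balance. -/
def IsReversible {V : Type u} (P : Matrix V V ℝ) (π : V → ℝ) : Prop :=
  ∀ x y, π x * P x y = π y * P y x

/-! ### Total variation mixing time -/

/-- Total variation distance `max_A |μ(A) - ν(A)|` on a finite set. -/
def tvDist {V : Type u} (μ ν : V → ℝ) : ℝ :=
  ⨆ A : Finset V, |∑ x ∈ A, μ x - ∑ x ∈ A, ν x|

/-- The total variation mixing time, the least `n` such that the law of the chain at time `n` is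
within distance `1/4` of `π`, for every starting point (and `∞` if there is no such `n`). -/
def tMix {V : Type u} [Fintype V] [DecidableEq V] (P : Matrix V V ℝ) (π : V → ℝ) : ℝ≥0∞ :=
  ⨅ n : ℕ, ⨅ _ : ∀ x, tvDist (fun y => (P ^ n) x y) π ≤ 1 / 4, (n : ℝ≥0∞)

/-! ### Randomized stopping rules -/

/-- A stopping rule: for each finite history `(x₀, …, xₙ)` of the chain, the probability of stopping
at time `n`, given that this history has been observed and that the chain was not stopped
before time `n`. -/
abbrev StoppingRule (V : Type u) : Type u :=
  (n : ℕ) → (Fin (n + 1) → V) → unitInterval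

/-- The probability that the chain started at `s` follows the trajectory `(x₀, …, xₙ)` up to
time `n` and is not stopped before time `n` by the rule `Γ`, that is,
`ℙ_s(X₀ = x₀, …, Xₙ = xₙ, τ ≥ n)`. -/
def reachProb {V : Type u} [DecidableEq V] (P : Matrix V V ℝ) (s : V) (Γ : StoppingRule V) :
    (n : ℕ) → (Fin (n + 1) → V) → ℝ
  | 0, x => if x 0 = s then 1 else 0
  | n + 1, x =>
      reachProb P s Γ n (Fin.init x) * (1 - (Γ n (Fin.init x) : ℝ)) *
        P (x (Fin.last n).castSucc) (x (Fin.last (n + 1)))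

/-- `ℙ_s(τ = n, Xₙ = y)`, where `τ` is the time at which the rule `Γ` stops. -/
def stopAtProb {V : Type u} [Fintype V] [DecidableEq V] (P : Matrix V V ℝ) (s : V)
    (Γ : StoppingRule V) (n : ℕ) (y : V) : ℝ :=
  ∑ x : Fin (n + 1) → V,
    if x (Fin.last n) = y then reachProb P s Γ n x * (Γ n x : ℝ) else 0

/-- `Γ` is a stopping rule from `s` to `π`: `ℙ_s(X_τ = y) = π(y)` for all `y`. As `π` has total
mass one, `τ` is then almost surely finite. -/
def IsRuleTo {V : Type u} [Fintype V] [DecidableEq V] (P : Matrix V V ℝ) (s : V)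
    (π : V → ℝ) (Γ : StoppingRule V) : Prop :=
  ∀ y, HasSum (fun n => stopAtProb P s Γ n y) (π y)

/-- `𝔼_s[τ] = ∑ n, n ℙ_s(τ = n)` for an almost surely finite stopping rule. -/
def expectedTime {V : Type u} [Fintype V] [DecidableEq V] (P : Matrix V V ℝ) (s : V)
    (Γ : StoppingRule V) : ℝ≥0∞ :=
  ∑' n : ℕ, (n : ℝ≥0∞) * ENNReal.ofReal (∑ y, stopAtProb P s Γ n y)

/-- `t_stop = max_s inf {𝔼_s[τ] : τ is a stopping rule from s to π}`. -/
def tStop {V : Type u} [Fintype V] [DecidableEq V] (P : Matrix V V ℝ) (π : V → ℝ) : ℝ≥0∞ :=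
  ⨆ s : V, ⨅ Γ : StoppingRule V, ⨅ _ : IsRuleTo P s π Γ, expectedTime P s Γ

/-! ### Rough isometry -/

/-- A correspondence: a relation without isolated points on either side. -/
def IsCorrespondence {V : Type u} {W : Type v} (R : V → W → Prop) : Prop :=
  (∀ x, ∃ y, R x y) ∧ ∀ y, ∃ x, R x y

/-- The set of ratios `(d' ∨ d + 1) / (d' ∧ d + 1)` over pairs in `R`, whose supremum is the
stretch of `R`. -/
def stretchSet {V : Type u} {W : Type v} (G : SimpleGraph V) (H : SimpleGraph W)
    (R : V → W → Prop) : Set ℝ :=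
  {q | ∃ x y x' y', R x x' ∧ R y y' ∧
    q = (max (H.dist x' y' : ℝ) (G.dist x y) + 1) / (min (H.dist x' y' : ℝ) (G.dist x y) + 1)}

/-- Connected graphs `G` and `H` are `r`-roughly isometric: some correspondence between their vertex
sets has stretch at most `r`. -/
def RoughlyIsometric {V : Type u} {W : Type v} (r : ℝ) (G : SimpleGraph V) (H : SimpleGraph W) :
    Prop :=
  ∃ R : V → W → Prop, IsCorrespondence R ∧ r ∈ upperBounds (stretchSet G H R)

/-- The maximum degree of a finite graph. -/
def maxDeg {V : Type u} [Fintype V] (G : SimpleGraph V) : ℕ := by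
  classical exact G.maxDegree

/-- `a` and `b` agree up to the multiplicative constant `C`. -/
def ComparableWith (C : ℝ≥0) (a b : ℝ≥0∞) : Prop :=
  a ≤ C * b ∧ b ≤ C * a

end MarkovRI

end

/-! Root `T` at a centroid `o` and let the branch weight of `w` be the sum of the sizes of the
branches (sets of descendants) at `w` and at each of its ancestors. The stopping times of both
chains, and their mixing times in the reversible case, are comparable to the maximal branch weight,
which depends on `T` alone. For `Y` this is the same statement as for `X`, with the identity as
coarse map (`exists_branchWeight_bounds`).

The potential theory rests on Green's formula `cut_identity`. If `(I - P) g = 1` on `A`, the net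
flow of `g` through the boundary of `A` is `π(A)`. By uniformity `π(A)` is comparable to the size of
`A` times the flow along any one edge, so `g` changes across a bottleneck by an amount comparable to
the size of `A`. No reversibility is needed, because flows are bounded below in both directions.

Upper bounds: fix a vertex `x₀` of `G` lying over a neighbourhood of `o`. Moving one generation away
from the root raises the expected hitting time of `x₀` by at most a multiple of the branch size, so
hitting times are bounded by branch weights (`IsHittingTime.le_branchWeight`). The stopping time is
at most the maximal hitting time of `x₀` for the chain plus that for its reversal (`tStop_le`). For
reversible lazy chains the mixing time is at most a constant times the maximal hitting time of any
one vertex (`tMix_le`), by `L²` decay of the density started there.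

Lower bounds: let `g` be the expected exit time from a set `S` lying over one branch, slightly below
the root. As `o` is a centroid, the complement of `S` has mass bounded below, so `g` bounds the
stopping time by weak duality (`le_tStop`) and the mixing time by iteration (`le_tMix`). Green's
formula and a Harnack inequality show that `g` gains a multiple of the branch size in every bounded
number of generations (`lower_step`, `lower_telescope`). The boundedly many generations lost near
the root and the leaf are absorbed in `exists_escapeBound_const`. -/

noncomputable section

namespace MarkovRI

/-! ### Potential theory of uniform, possibly non-reversible, chains -/

section Flow

variable {V : Type u} [Fintype V]

/-- A stochastic matrix with positive stationary distribution whose off-diagonal entries live on the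
edges of `G`, and for which the stationary flow along every edge, in either direction, dominates
every stationary probability up to the factor `K`. -/
structure IsUniformFlow (G : SimpleGraph V) (P : Matrix V V ℝ) (π : V → ℝ) (K : ℝ) : Prop where
  nonneg : ∀ x y, 0 ≤ P x y
  row_sum : ∀ x, ∑ y, P x y = 1
  pi_pos : ∀ x, 0 < π x
  pi_sum : ∑ x, π x = 1
  stationary : ∀ y, ∑ x, π x * P x y = π y
  support : ∀ x y, x ≠ y → ¬ G.Adj x y → P x y = 0
  const_pos : 0 < K
  le_flow : ∀ x y z, G.Adj x y → π z ≤ K * (π x * P x y)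
  connected : G.Connected
  nontrivial : Nontrivial V

/-- The time reversal of a chain with respect to `π`. -/
def reversal (P : Matrix V V ℝ) (π : V → ℝ) : Matrix V V ℝ := fun x y => π y * P y x / π x

variable {G : SimpleGraph V} {P : Matrix V V ℝ} {π : V → ℝ} {K : ℝ}

namespace IsUniformFlow

/-- The class is closed under time reversal because `le_flow` bounds the flow from below in both
directions of an edge. Every hitting time estimate therefore holds for the reversal too, as
`tStop_le` requires. -/
lemma reversed (h : IsUniformFlow G P π K) : IsUniformFlow G (reversal P π) π K := by
  have key : ∀ x y, π x * reversal P π x y = π y * P y x := fun x y => by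
    have := (h.pi_pos x).ne'
    simp only [reversal]; field_simp
  refine ⟨fun x y => ?_, fun x => ?_, h.pi_pos, h.pi_sum, fun y => ?_, fun x y hxy hn => ?_,
    h.const_pos, fun x y z hxy => ?_, h.connected, h.nontrivial⟩
  · exact div_nonneg (mul_nonneg (h.pi_pos y).le (h.nonneg y x)) (h.pi_pos x).le
  · simp only [reversal]
    rw [← Finset.sum_div, h.stationary, div_self (h.pi_pos x).ne']
  · simp only [key]
    rw [← Finset.mul_sum, h.row_sum, mul_one]
  · simp only [reversal]
    rw [h.support y x hxy.symm (fun e => hn e.symm)]; simp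
  · rw [key]; exact h.le_flow y x z hxy.symm

lemma one_le_mul (h : IsUniformFlow G P π K) {x y : V} (hxy : G.Adj x y) : 1 ≤ K * P x y := by
  have h1 := h.le_flow x y x hxy
  have h2 := h.pi_pos x
  by_contra hc
  push Not at hc
  nlinarith

lemma pos_of_adj (h : IsUniformFlow G P π K) {x y : V} (hxy : G.Adj x y) : 0 < P x y := by
  have h1 := h.one_le_mul hxy
  have h2 := h.const_pos
  by_contra hc
  push Not at hc
  nlinarith

lemma exists_adj (h : IsUniformFlow G P π K) (x : V) : ∃ y, G.Adj x y := by
  have := h.nontrivial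
  exact h.connected.preconnected.exists_adj_of_nontrivial x

lemma le_one (h : IsUniformFlow G P π K) (x y : V) : P x y ≤ 1 := by
  rw [← h.row_sum x]
  exact Finset.single_le_sum (fun z _ => h.nonneg x z) (Finset.mem_univ y)

lemma pi_le (h : IsUniformFlow G P π K) (x z : V) : π x ≤ K * π z := by
  obtain ⟨y, hy⟩ := h.exists_adj z
  refine (h.le_flow z y x hy).trans (mul_le_mul_of_nonneg_left ?_ h.const_pos.le)
  have := h.le_one z y
  have := h.pi_pos z
  nlinarith

lemma one_le_card_mul (h : IsUniformFlow G P π K) (z : V) : 1 ≤ K * Fintype.card V * π z := by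
  calc (1 : ℝ) = ∑ x, π x := h.pi_sum.symm
    _ ≤ ∑ _x : V, K * π z := Finset.sum_le_sum fun x _ => h.pi_le x z
    _ = _ := by simp; ring

lemma sum_mul_le_of_nbr (h : IsUniformFlow G P π K) (x : V) {f f' : V → ℝ}
    (hx : f x ≤ f' x) (hf : ∀ y, G.Adj x y → f y ≤ f' y) :
    ∑ y, P x y * f y ≤ ∑ y, P x y * f' y := by
  refine Finset.sum_le_sum fun y _ => ?_
  by_cases hxy : x = y
  · subst hxy; exact mul_le_mul_of_nonneg_left hx (h.nonneg _ _)
  by_cases ha : G.Adj x y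
  · exact mul_le_mul_of_nonneg_left (hf y ha) (h.nonneg _ _)
  · rw [h.support x y hxy ha]; simp

/-- Green's formula across the boundary of `A`. -/
lemma cut_identity [DecidableEq V] (h : IsUniformFlow G P π K) (A : Finset V) (g : V → ℝ)
    (a : ℝ) :
    ∑ x ∈ A, ∑ y ∈ Aᶜ, (π y * P y x * (g x - a) + π x * P x y * (a - g y)) =
      ∑ x ∈ A, π x * (g x - ∑ y, P x y * g y) := by
  have e : ∀ x, π x * (g x - ∑ y, P x y * g y) =
      ∑ y, (π y * P y x * (g x - a) + π x * P x y * (a - g y)) := fun x => by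
    have h1 := h.stationary x
    have h2 := h.row_sum x
    rw [Finset.sum_add_distrib, ← Finset.sum_mul, h1]
    have : ∑ y, π x * P x y * (a - g y) = π x * (a * ∑ y, P x y - ∑ y, P x y * g y) := by
      rw [Finset.mul_sum, ← Finset.sum_sub_distrib, Finset.mul_sum]
      exact Finset.sum_congr rfl fun y _ => by ring
    rw [this, h2]; ring
  simp only [e]
  have e2 : ∀ x, ∑ y, (π y * P y x * (g x - a) + π x * P x y * (a - g y)) =
      ∑ y ∈ A, (π y * P y x * (g x - a) + π x * P x y * (a - g y)) +
      ∑ y ∈ Aᶜ, (π y * P y x * (g x - a) + π x * P x y * (a - g y)) := fun x =>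
    (Finset.sum_add_sum_compl A _).symm
  simp only [e2]
  -- What remains is that the double sum over `A × A` vanishes: exchanging `x` and `y` changes the
  -- sign of the summand.
  rw [Finset.sum_add_distrib, eq_comm, add_eq_right]
  simp only [Finset.sum_add_distrib]
  rw [Finset.sum_comm, ← Finset.sum_add_distrib]
  refine Finset.sum_eq_zero fun x _ => ?_
  rw [← Finset.sum_add_distrib]
  refine Finset.sum_eq_zero fun y _ => by ring

/-- A solution of `(I - P) g = 1` on `A` that is at most `a` on the outer boundary of `A` drops by at
most `K * |A|` across an edge, as long as it stays above `a`. -/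
lemma le_max_add [DecidableEq V] (h : IsUniformFlow G P π K) {A : Finset V} {g : V → ℝ} {a : ℝ}
    (hg : ∀ x ∈ A, g x = 1 + ∑ y, P x y * g y)
    (hA : ∀ x ∈ A, ∀ y ∉ A, G.Adj x y → g y ≤ a) {x y : V} (hx : x ∈ A) (hxy : G.Adj x y) :
    g x ≤ max (g y) a + K * A.card := by
  set b := max (g y) a with hb
  by_cases hgx : g x ≤ b
  · have := mul_nonneg h.const_pos.le (Nat.cast_nonneg (α := ℝ) A.card)
    linarith
  push Not at hgx
  -- Green's formula is applied to the superlevel set `B` at level `b`. All boundary terms are then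
  -- nonnegative, so the term of the edge from `x` to `y` alone is at most `π(B)`, and `π(B)` is at
  -- most `K` times the size of `B` times the flow from `y` to `x`.
  set B := A.filter fun z => b < g z with hB
  have hxB : x ∈ B := by simp [hB, hx, hgx]
  have hyB : y ∉ B := by simp [hB, hb]
  have hBA : B ⊆ A := Finset.filter_subset _ _
  have id := h.cut_identity B g b
  have r : ∑ z ∈ B, π z * (g z - ∑ y, P z y * g y) = ∑ z ∈ B, π z :=
    Finset.sum_congr rfl fun z hz => by rw [hg z (hBA hz)]; ring
  rw [r] at id
  have nn : ∀ z ∈ B, ∀ w ∈ Bᶜ, 0 ≤ π w * P w z * (g z - b) + π z * P z w * (b - g w) := by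
    intro z hz w hw
    rw [Finset.mem_compl] at hw
    have hzb : b < g z := (Finset.mem_filter.1 hz).2
    have hne : z ≠ w := fun e => hw (e ▸ hz)
    have h1 := mul_nonneg (h.pi_pos w).le (h.nonneg w z)
    have h2 := mul_nonneg (h.pi_pos z).le (h.nonneg z w)
    by_cases ha : G.Adj z w
    · have : g w ≤ b := by
        by_cases hwA : w ∈ A
        · by_contra hc
          push Not at hc
          exact hw (Finset.mem_filter.2 ⟨hwA, hc⟩)
        · exact (hA z (hBA hz) w hwA ha).trans (le_max_right _ _)
      exact add_nonneg (mul_nonneg h1 (by linarith)) (mul_nonneg h2 (by linarith))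
    · rw [h.support z w hne ha]
      simpa using mul_nonneg h1 (by linarith)
  have s1 : π y * P y x * (g x - b) ≤ ∑ z ∈ B, π z := by
    rw [← id]
    calc π y * P y x * (g x - b)
        ≤ π y * P y x * (g x - b) + π x * P x y * (b - g y) := by
          have := mul_nonneg (h.pi_pos x).le (h.nonneg x y)
          have := mul_nonneg this (sub_nonneg.2 (le_max_left (g y) a))
          linarith
      _ ≤ ∑ w ∈ Bᶜ, (π w * P w x * (g x - b) + π x * P x w * (b - g w)) :=
          Finset.single_le_sum (f := fun w => π w * P w x * (g x - b) + π x * P x w * (b - g w))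
            (nn x hxB) (by simpa using hyB)
      _ ≤ _ := Finset.single_le_sum
            (f := fun z => ∑ w ∈ Bᶜ, (π w * P w z * (g z - b) + π z * P z w * (b - g w)))
            (fun z hz => Finset.sum_nonneg (nn z hz)) hxB
  have s2 : ∑ z ∈ B, π z ≤ B.card * (K * (π y * P y x)) := by
    rw [← nsmul_eq_mul]
    exact Finset.sum_le_card_nsmul _ _ _ fun z _ => h.le_flow y x z hxy.symm
  have pc : 0 < π y * P y x := mul_pos (h.pi_pos y) (h.pos_of_adj hxy.symm)
  have s3 : g x - b ≤ K * B.card := by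
    have : π y * P y x * (g x - b) ≤ π y * P y x * (K * B.card) := by nlinarith
    exact le_of_mul_le_mul_left this pc
  have s4 : (B.card : ℝ) ≤ A.card := by exact_mod_cast Finset.card_le_card hBA
  have := mul_le_mul_of_nonneg_left s4 h.const_pos.le
  linarith

/-- The previous bound, iterated along a walk. -/
lemma le_add_length_mul [DecidableEq V] (h : IsUniformFlow G P π K) {A : Finset V} {g : V → ℝ}
    {a : ℝ} (hg : ∀ x ∈ A, g x = 1 + ∑ y, P x y * g y)
    (hA : ∀ x ∈ A, ∀ y ∉ A, G.Adj x y → g y ≤ a) {x z : V} (p : G.Walk x z)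
    (hz : g z ≤ a) (hx : x ∈ A) : g x ≤ a + p.length * (K * A.card) := by
  have hK : 0 ≤ K * A.card := mul_nonneg h.const_pos.le (Nat.cast_nonneg (α := ℝ) A.card)
  induction p with
  | nil => simpa using hz
  | @cons x y z hxy p ih =>
    have h1 := h.le_max_add hg hA hx hxy
    have h2 : g y ≤ a + p.length * (K * A.card) := by
      by_cases hy : y ∈ A
      · exact ih hz hy
      · have := hA x hx y hy hxy
        have : (0 : ℝ) ≤ p.length * (K * A.card) := mul_nonneg (Nat.cast_nonneg _) hK
        linarith
    have h3 : max (g y) a ≤ a + p.length * (K * A.card) :=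
      max_le h2 (by have : (0 : ℝ) ≤ p.length * (K * A.card) := mul_nonneg (Nat.cast_nonneg _) hK
                    linarith)
    rw [SimpleGraph.Walk.length_cons]
    push_cast
    linarith

/-- At a minimum of `g` over `A` lying below `b`, the average of `g` would be at least `g`,
contradicting the extra `1` in the equation. -/
lemma le_of_superharmonic (h : IsUniformFlow G P π K) {A : Finset V} {g : V → ℝ} {b : ℝ}
    (hg : ∀ x ∈ A, g x = 1 + ∑ y, P x y * g y)
    (hA : ∀ x ∈ A, ∀ y ∉ A, G.Adj x y → b ≤ g y) : ∀ x ∈ A, b ≤ g x := by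
  intro x hx
  obtain ⟨z, hz, hmin⟩ := Finset.exists_min_image A g ⟨x, hx⟩
  refine le_trans ?_ (hmin x hx)
  by_contra hc
  push Not at hc
  have := h.sum_mul_le_of_nbr z (f := fun _ => g z) (f' := g) le_rfl (fun y hy => by
    by_cases hyA : y ∈ A
    · exact hmin y hyA
    · exact hc.le.trans (hA z hz y hyA hy))
  rw [← Finset.sum_mul, h.row_sum, one_mul] at this
  linarith [hg z hz]

/-- Maximum principle for functions that are subharmonic on a proper subset. -/
lemma nonpos_of_subharmonic (h : IsUniformFlow G P π K) {S : Finset V} (hS : ∃ z, z ∉ S)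
    {f : V → ℝ} (hf : ∀ x ∈ S, f x ≤ ∑ y, P x y * f y) (h0 : ∀ x ∉ S, f x ≤ 0) (x : V) :
    f x ≤ 0 := by
  have := h.nontrivial
  obtain ⟨m, hm⟩ := Finite.exists_max f
  by_contra hc
  push Not at hc
  have hpos : 0 < f m := hc.trans_le (hm x)
  -- A positive maximum is attained inside `S` and spreads to all neighbours, hence by connectedness
  -- to a point outside `S`, where `f ≤ 0`.
  have step : ∀ a b, G.Adj a b → f a = f m → f b = f m := by
    intro a b hab ha
    have haS : a ∈ S := by
      by_contra hn
      linarith [h0 a hn]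
    have h1 : ∑ y, P a y * (f m - f y) ≤ 0 := by
      simp only [mul_sub, Finset.sum_sub_distrib]
      rw [← Finset.sum_mul, h.row_sum]
      linarith [hf a haS]
    have h2 : ∀ y ∈ Finset.univ, 0 ≤ P a y * (f m - f y) := fun y _ =>
      mul_nonneg (h.nonneg _ _) (sub_nonneg.2 (hm y))
    have h3 := (Finset.sum_eq_zero_iff_of_nonneg h2).1
      (le_antisymm h1 (Finset.sum_nonneg h2)) b (Finset.mem_univ b)
    rcases mul_eq_zero.1 h3 with h4 | h4
    · exact absurd h4 (h.pos_of_adj hab).ne'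
    · linarith
  have walk : ∀ a b (_ : G.Walk a b), f a = f m → f b = f m := by
    intro a b p
    induction p with
    | nil => exact id
    | cons hab _ ih => exact fun ha => ih (step _ _ hab ha)
  obtain ⟨z, hz⟩ := hS
  obtain ⟨p⟩ := h.connected.preconnected m z
  linarith [walk m z p rfl, h0 z hz]

/-- Solvability of the Dirichlet problem on a proper subset. -/
lemma exists_dirichlet (h : IsUniformFlow G P π K) {S : Finset V} (hS : ∃ z, z ∉ S)
    (b : V → ℝ) :
    ∃ f : V → ℝ, (∀ x ∉ S, f x = 0) ∧ ∀ x ∈ S, f x = b x + ∑ y, P x y * f y := by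
  classical
  -- The operator is `I - P` on `S` and the identity off `S`. The maximum principle makes it
  -- injective, hence surjective by finite dimension.
  let L : (V → ℝ) →ₗ[ℝ] (V → ℝ) :=
    { toFun := fun f x => if x ∈ S then f x - ∑ y, P x y * f y else f x
      map_add' := fun f g => by
        ext x
        by_cases hx : x ∈ S
        · simp [hx, mul_add, Finset.sum_add_distrib]; ring
        · simp [hx]
      map_smul' := fun c f => by
        ext x
        by_cases hx : x ∈ S
        · simp only [hx, if_true, Pi.smul_apply, smul_eq_mul, RingHom.id_apply, mul_sub,
            Finset.mul_sum]
          congr 1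
          exact Finset.sum_congr rfl fun y _ => by ring
        · simp [hx] }
  have inj : Function.Injective L := by
    rw [← LinearMap.ker_eq_bot, LinearMap.ker_eq_bot']
    intro f hf
    have hf' : ∀ x, (if x ∈ S then f x - ∑ y, P x y * f y else f x) = 0 := fun x => congrFun hf x
    have hin : ∀ x ∈ S, f x = ∑ y, P x y * f y := fun x hx => by
      have := hf' x; rw [if_pos hx] at this; linarith
    have hout : ∀ x ∉ S, f x = 0 := fun x hx => by
      have := hf' x; rwa [if_neg hx] at this
    ext x
    refine le_antisymm (h.nonpos_of_subharmonic hS (fun x hx => (hin x hx).le)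
      (fun x hx => (hout x hx).le) x) ?_
    have := h.nonpos_of_subharmonic hS (f := fun x => - f x)
      (fun x hx => by simp only [mul_neg, Finset.sum_neg_distrib]; rw [hin x hx])
      (fun x hx => by rw [hout x hx, neg_zero]) x
    simpa using this
  obtain ⟨f, hf⟩ := LinearMap.injective_iff_surjective.1 inj (fun x => if x ∈ S then b x else 0)
  have hf' : ∀ x, (if x ∈ S then f x - ∑ y, P x y * f y else f x) = if x ∈ S then b x else 0 :=
    fun x => congrFun hf x
  refine ⟨f, fun x hx => ?_, fun x hx => ?_⟩
  · have := hf' x; rwa [if_neg hx, if_neg hx] at this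
  · have := hf' x; rw [if_pos hx, if_pos hx] at this; linarith

lemma nonneg_of_dirichlet (h : IsUniformFlow G P π K) {S : Finset V} (hS : ∃ z, z ∉ S)
    {b f : V → ℝ} (hb : ∀ x, 0 ≤ b x) (h0 : ∀ x ∉ S, f x = 0)
    (hf : ∀ x ∈ S, f x = b x + ∑ y, P x y * f y) (x : V) : 0 ≤ f x := by
  have := h.nonpos_of_subharmonic hS (f := fun x => - f x)
      (fun x hx => by
        simp only [mul_neg, Finset.sum_neg_distrib]; linarith [hf x hx, hb x])
      (fun x hx => by rw [h0 x hx, neg_zero]) x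
  simpa using this

/-- `g` is the expected hitting time of `o`. -/
structure _root_.MarkovRI.IsHittingTime (P : Matrix V V ℝ) (o : V) (g : V → ℝ) : Prop where
  root : g o = 0
  nonneg : ∀ x, 0 ≤ g x
  eqn : ∀ x, x ≠ o → g x = 1 + ∑ y, P x y * g y

lemma exists_hittingTime (h : IsUniformFlow G P π K) (o : V) : ∃ g, IsHittingTime P o g := by
  classical
  have hS : ∃ z, z ∉ (Finset.univ.erase o : Finset V) := ⟨o, by simp⟩
  obtain ⟨g, h0, hg⟩ := h.exists_dirichlet hS (fun _ => 1)
  exact ⟨g, h0 o (by simp), h.nonneg_of_dirichlet hS (fun _ => zero_le_one) h0 hg,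
    fun x hx => hg x (by simp [hx])⟩

/-- Integrating `(I - P) f` against the stationary distribution gives zero. -/
lemma sum_pi_mul_sum (h : IsUniformFlow G P π K) (f : V → ℝ) :
    ∑ x, π x * ∑ y, P x y * f y = ∑ x, π x * f x := by
  simp only [Finset.mul_sum]
  rw [Finset.sum_comm]
  refine Finset.sum_congr rfl fun y _ => ?_
  rw [← h.stationary y, Finset.sum_mul]
  exact Finset.sum_congr rfl fun x _ => by ring

/-- A function vanishing at `o`, with prescribed Laplacian elsewhere, has its Laplacian at `o`
determined by stationarity. -/
lemma laplacian_at_root [DecidableEq V] (h : IsUniformFlow G P π K) {o : V} {f b : V → ℝ}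
    (hf : ∀ x, x ≠ o → f x = b x + ∑ y, P x y * f y) :
    π o * (∑ y, P o y * f y - f o) = ∑ x ∈ Finset.univ.erase o, π x * b x := by
  have h1 := h.sum_pi_mul_sum f
  rw [← Finset.add_sum_erase _ _ (Finset.mem_univ o),
    ← Finset.add_sum_erase (a := o) (f := fun x => π x * f x) _ (Finset.mem_univ o)] at h1
  have h2 : ∑ x ∈ Finset.univ.erase o, π x * f x =
      ∑ x ∈ Finset.univ.erase o, π x * b x +
        ∑ x ∈ Finset.univ.erase o, π x * ∑ y, P x y * f y := by
    rw [← Finset.sum_add_distrib]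
    refine Finset.sum_congr rfl fun x hx => ?_
    rw [← mul_add, ← hf x (Finset.ne_of_mem_erase hx)]
  rw [mul_sub]
  linarith

end IsUniformFlow

/-- Kac's formula: the expected return time to `o` is `1 / π o`. -/
lemma IsHittingTime.at_root (h : IsUniformFlow G P π K) {o : V} {g : V → ℝ}
    (hg : IsHittingTime P o g) : ∑ y, P o y * g y = 1 / π o - 1 := by
  classical
  have h1 := h.laplacian_at_root (b := fun _ => 1) hg.eqn
  have h2 := h.pi_sum
  rw [← Finset.add_sum_erase _ _ (Finset.mem_univ o)] at h2
  simp only [mul_one, hg.root, sub_zero] at h1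
  have := (h.pi_pos o).ne'
  field_simp
  linarith

end Flow

/-! ### Stopping rules: exit frequencies and duality -/

section Stopping

lemma reachProb_nonneg {V : Type u} [DecidableEq V] {P : Matrix V V ℝ} (hP : ∀ x y, 0 ≤ P x y) (s : V) (Γ : StoppingRule V)
    (n : ℕ) (x : Fin (n + 1) → V) : 0 ≤ reachProb P s Γ n x := by
  induction n with
  | zero => simp only [reachProb]; split_ifs <;> norm_num
  | succ n ih =>
    simp only [reachProb]
    exact mul_nonneg (mul_nonneg (ih _) (sub_nonneg.2 (Γ n _).2.2)) (hP _ _)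

variable {V : Type u} [Fintype V] [DecidableEq V]

/-- `ℙ_s(τ ≥ n, Xₙ = y)`. -/
def arriveProb (P : Matrix V V ℝ) (s : V) (Γ : StoppingRule V) (n : ℕ) (y : V) : ℝ :=
  ∑ x : Fin (n + 1) → V, if x (Fin.last n) = y then reachProb P s Γ n x else 0

lemma sum_arriveProb_mul (P : Matrix V V ℝ) (s : V) (Γ : StoppingRule V) (n : ℕ) (f : V → ℝ) :
    ∑ y, arriveProb P s Γ n y * f y =
      ∑ x : Fin (n + 1) → V, reachProb P s Γ n x * f (x (Fin.last n)) := by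
  simp only [arriveProb, Finset.sum_mul]
  rw [Finset.sum_comm]
  refine Finset.sum_congr rfl fun x _ => ?_
  rw [Finset.sum_eq_single (x (Fin.last n))] <;> simp +contextual [eq_comm]

lemma sum_stopAtProb_mul (P : Matrix V V ℝ) (s : V) (Γ : StoppingRule V) (n : ℕ) (f : V → ℝ) :
    ∑ y, stopAtProb P s Γ n y * f y =
      ∑ x : Fin (n + 1) → V, reachProb P s Γ n x * (Γ n x : ℝ) * f (x (Fin.last n)) := by
  simp only [stopAtProb, Finset.sum_mul]
  rw [Finset.sum_comm]
  refine Finset.sum_congr rfl fun x _ => ?_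
  rw [Finset.sum_eq_single (x (Fin.last n))] <;> simp +contextual [eq_comm]

lemma arriveProb_zero (P : Matrix V V ℝ) (s : V) (Γ : StoppingRule V) (y : V) :
    arriveProb P s Γ 0 y = if y = s then 1 else 0 := by
  rw [arriveProb, ← (Equiv.funUnique (Fin 1) V).symm.sum_comp]
  simp only [reachProb]
  simp only [Equiv.funUnique_symm_apply, uniqueElim_const]
  rw [Finset.sum_eq_single y] <;> simp +contextual

/-- The Markov property, obtained by splitting off the last vertex of a trajectory: mass that
arrives and does not stop moves on by `P`. -/
lemma arriveProb_succ (P : Matrix V V ℝ) (s : V) (Γ : StoppingRule V) (n : ℕ) (y : V) :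
    arriveProb P s Γ (n + 1) y =
      ∑ z, (arriveProb P s Γ n z - stopAtProb P s Γ n z) * P z y := by
  simp only [sub_mul, Finset.sum_sub_distrib]
  rw [sum_arriveProb_mul, sum_stopAtProb_mul, ← Finset.sum_sub_distrib, arriveProb,
    ← (Fin.snocEquiv fun _ => V).sum_comp, Fintype.sum_prod_type, Finset.sum_comm]
  refine Finset.sum_congr rfl fun x _ => ?_
  rw [Finset.sum_eq_single y]
  · have e : Fin.init ((Fin.snocEquiv fun _ => V) (y, x)) = x := Fin.init_snoc _ _
    simp only [reachProb, e]
    simp only [Fin.snocEquiv_apply, Fin.snoc_last, if_true, Fin.snoc_castSucc]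
    ring
  · intro b _ hb
    simp [hb]
  · simp

lemma stopAtProb_nonneg {P : Matrix V V ℝ} (hP : ∀ x y, 0 ≤ P x y) (s : V) (Γ : StoppingRule V)
    (n : ℕ) (y : V) : 0 ≤ stopAtProb P s Γ n y := by
  refine Finset.sum_nonneg fun x _ => ?_
  split_ifs
  · exact mul_nonneg (reachProb_nonneg hP _ _ _ _) (Γ n x).2.1
  · exact le_rfl

lemma stopAtProb_le_arriveProb {P : Matrix V V ℝ} (hP : ∀ x y, 0 ≤ P x y) (s : V)
    (Γ : StoppingRule V) (n : ℕ) (y : V) : stopAtProb P s Γ n y ≤ arriveProb P s Γ n y := by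
  refine Finset.sum_le_sum fun x _ => ?_
  split_ifs
  · exact mul_le_of_le_one_right (reachProb_nonneg hP _ _ _ _) (Γ n x).2.2
  · exact le_rfl

lemma arriveProb_nonneg {P : Matrix V V ℝ} (hP : ∀ x y, 0 ≤ P x y) (s : V) (Γ : StoppingRule V)
    (n : ℕ) (y : V) : 0 ≤ arriveProb P s Γ n y :=
  (stopAtProb_nonneg hP s Γ n y).trans (stopAtProb_le_arriveProb hP s Γ n y)

lemma sum_arriveProb_zero (P : Matrix V V ℝ) (s : V) (Γ : StoppingRule V) :
    ∑ y, arriveProb P s Γ 0 y = 1 := by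
  simp [arriveProb_zero]

lemma sum_arriveProb_succ {P : Matrix V V ℝ} (hP : ∀ x, ∑ y, P x y = 1) (s : V)
    (Γ : StoppingRule V) (n : ℕ) :
    ∑ y, arriveProb P s Γ (n + 1) y =
      ∑ y, arriveProb P s Γ n y - ∑ y, stopAtProb P s Γ n y := by
  simp only [arriveProb_succ]
  rw [Finset.sum_comm, ← Finset.sum_sub_distrib]
  simp [← Finset.mul_sum, hP]

lemma sum_arriveProb_eq {P : Matrix V V ℝ} (hP : ∀ x, ∑ y, P x y = 1) (s : V)
    (Γ : StoppingRule V) (n : ℕ) :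
    ∑ y, arriveProb P s Γ n y = 1 - ∑ k ∈ Finset.range n, ∑ y, stopAtProb P s Γ k y := by
  induction n with
  | zero => simp [sum_arriveProb_zero]
  | succ n ih => rw [sum_arriveProb_succ hP, ih, Finset.sum_range_succ]; ring

/-- Both sides are `𝔼[min(τ, n)]`: the left as a sum of tail probabilities, the right by the value
of `τ`, with the mass still alive at time `n` counted `n` times. -/
lemma sum_range_sum_arriveProb {P : Matrix V V ℝ} (hP : ∀ x, ∑ y, P x y = 1) (s : V)
    (Γ : StoppingRule V) (n : ℕ) :
    ∑ k ∈ Finset.range n, ∑ y, arriveProb P s Γ (k + 1) y =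
      ∑ k ∈ Finset.range n, (k : ℝ) * ∑ y, stopAtProb P s Γ k y +
        n * ∑ y, arriveProb P s Γ n y := by
  induction n with
  | zero => simp
  | succ n ih =>
    rw [Finset.sum_range_succ, ih, Finset.sum_range_succ, sum_arriveProb_succ hP s Γ n]
    push_cast; ring

/-- A stopping rule that halts at `v` with probability depending only on `v`. -/
def vertexRule (q : V → ℝ) (hq : ∀ v, q v ∈ Set.Icc (0 : ℝ) 1) : StoppingRule V :=
  fun n x => ⟨q (x (Fin.last n)), hq _⟩

lemma stopAtProb_vertexRule (P : Matrix V V ℝ) (s : V) {q : V → ℝ}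
    (hq : ∀ v, q v ∈ Set.Icc (0 : ℝ) 1) (n : ℕ) (y : V) :
    stopAtProb P s (vertexRule q hq) n y = arriveProb P s (vertexRule q hq) n y * q y := by
  rw [stopAtProb, arriveProb, Finset.sum_mul]
  refine Finset.sum_congr rfl fun x _ => ?_
  split_ifs with h
  · simp [vertexRule, h]
  · simp

variable {G : SimpleGraph V} {P : Matrix V V ℝ} {π : V → ℝ} {K : ℝ}

/-- A nonnegative solution of the conservation equation gives a stopping rule with these exit
frequencies. -/
lemma IsUniformFlow.exists_rule (h : IsUniformFlow G P π K) (s : V) {x : V → ℝ}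
    (hx : ∀ v, 0 ≤ x v)
    (hxP : ∀ v, x v = (if v = s then 1 else 0) - π v + ∑ u, x u * P u v) :
    ∃ Γ, IsRuleTo P s π Γ ∧ expectedTime P s Γ ≤ ENNReal.ofReal (∑ v, x v) := by
  have := h.nontrivial
  have hy : ∀ v, 0 < π v + x v := fun v => add_pos_of_pos_of_nonneg (h.pi_pos v) (hx v)
  -- Of `π v + x v` expected arrivals at `v`, `π v` should stop and `x v` should leave, so each
  -- arrival stops with the corresponding probability.
  set q : V → ℝ := fun v => π v / (π v + x v) with hqdef
  have hq : ∀ v, q v ∈ Set.Icc (0 : ℝ) 1 := fun v =>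
    ⟨div_nonneg (h.pi_pos v).le (hy v).le, (div_le_one (hy v)).2 (by linarith [hx v])⟩
  set Γ := vertexRule q hq
  set a := arriveProb P s Γ with ha
  have anon : ∀ n v, 0 ≤ a n v := arriveProb_nonneg h.nonneg s Γ
  have astep : ∀ n v, a (n + 1) v = ∑ u, a n u * (1 - q u) * P u v := fun n v => by
    rw [ha, arriveProb_succ]
    refine Finset.sum_congr rfl fun u _ => ?_
    rw [stopAtProb_vertexRule]; ring
  have yq : ∀ v, (π v + x v) * (1 - q v) = x v := fun v => by
    have := (hy v).ne'
    simp only [hqdef]; field_simp; ring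
  -- the part of the mass that has not been accounted for after `n` steps
  set e : ℕ → V → ℝ := fun n v => π v + x v - ∑ k ∈ Finset.range n, a k v with he
  have estep : ∀ n v, e (n + 1) v = ∑ u, e n u * (1 - q u) * P u v := by
    intro n v
    have h1 : ∑ u, e n u * (1 - q u) * P u v =
        ∑ u, x u * P u v - ∑ k ∈ Finset.range n, a (k + 1) v := by
      simp only [astep]
      rw [Finset.sum_comm, ← Finset.sum_sub_distrib]
      refine Finset.sum_congr rfl fun u _ => ?_
      rw [← yq u]
      simp only [he, sub_mul, Finset.sum_mul]
    rw [h1]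
    simp only [he]
    rw [Finset.sum_range_succ', ha, arriveProb_zero]
    linarith [hxP v]
  have enon : ∀ n v, 0 ≤ e n v := by
    intro n
    induction n with
    | zero => intro v; simpa [he] using (hy v).le
    | succ n ih =>
      intro v
      rw [estep]
      exact Finset.sum_nonneg fun u _ =>
        mul_nonneg (mul_nonneg (ih u) (sub_nonneg.2 (hq u).2)) (h.nonneg _ _)
  -- The missing mass `e` is nonnegative and propagates like the surviving chain. Stopping
  -- probabilities are bounded below by `q m > 0`, so it decays geometrically and the arrivals sum
  -- to `π v + x v`.
  obtain ⟨m, hm⟩ := Finite.exists_min q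
  have qm : 0 < q m := div_pos (h.pi_pos m) (hy m)
  have esum : ∀ n, ∑ v, e n v ≤ (1 - q m) ^ n * ∑ v, e 0 v := by
    intro n
    induction n with
    | zero => simp
    | succ n ih =>
      simp only [estep]
      rw [Finset.sum_comm]
      simp only [← Finset.mul_sum, h.row_sum, mul_one]
      calc ∑ u, e n u * (1 - q u) ≤ ∑ u, e n u * (1 - q m) :=
            Finset.sum_le_sum fun u _ =>
              mul_le_mul_of_nonneg_left (by linarith [hm u]) (enon n u)
        _ = (1 - q m) * ∑ u, e n u := by rw [← Finset.sum_mul, mul_comm]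
        _ ≤ (1 - q m) * ((1 - q m) ^ n * ∑ v, e 0 v) :=
            mul_le_mul_of_nonneg_left ih (sub_nonneg.2 (hq m).2)
        _ = _ := by rw [pow_succ]; ring
  have etend : ∀ v, Filter.Tendsto (fun n => e n v) Filter.atTop (nhds 0) := by
    intro v
    have lim : Filter.Tendsto (fun n => (1 - q m) ^ n * ∑ v, e 0 v) Filter.atTop (nhds 0) := by
      simpa using (tendsto_pow_atTop_nhds_zero_of_lt_one (sub_nonneg.2 (hq m).2)
        (by linarith : 1 - q m < 1)).mul_const (∑ v, e 0 v)
    refine squeeze_zero (fun n => enon n v) (fun n => ?_) lim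
    exact (Finset.single_le_sum (fun u _ => enon n u) (Finset.mem_univ v)).trans (esum n)
  have asum : ∀ v, HasSum (fun n => a n v) (π v + x v) := by
    intro v
    rw [hasSum_iff_tendsto_nat_of_nonneg (fun n => anon n v)]
    have := (tendsto_const_nhds (x := π v + x v)).sub (etend v)
    simpa [he] using this
  refine ⟨Γ, fun v => ?_, ?_⟩
  · have := (asum v).mul_right (q v)
    have e2 : (π v + x v) * q v = π v := by
      have := (hy v).ne'
      simp only [hqdef]; field_simp
    rw [e2] at this
    exact this.congr_fun fun n => stopAtProb_vertexRule P s hq n v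
  · refine ENNReal.tsum_le_of_sum_range_le fun n => ?_
    have snon : ∀ k, 0 ≤ ∑ y, stopAtProb P s Γ k y := fun k =>
      Finset.sum_nonneg fun y _ => stopAtProb_nonneg h.nonneg s Γ k y
    have : ∀ k : ℕ, (k : ℝ≥0∞) * ENNReal.ofReal (∑ y, stopAtProb P s Γ k y) =
        ENNReal.ofReal (k * ∑ y, stopAtProb P s Γ k y) := fun k => by
      rw [ENNReal.ofReal_mul (Nat.cast_nonneg _), ENNReal.ofReal_natCast]
    simp only [this]
    rw [← ENNReal.ofReal_sum_of_nonneg fun k _ => mul_nonneg (Nat.cast_nonneg _) (snon k)]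
    refine ENNReal.ofReal_le_ofReal ?_
    have h1 := sum_range_sum_arriveProb h.row_sum s Γ n
    have h2 : ∑ k ∈ Finset.range n, ∑ y, arriveProb P s Γ (k + 1) y ≤ ∑ v, x v := by
      have h3 : ∑ k ∈ Finset.range (n + 1), ∑ y, a k y ≤ ∑ v, (π v + x v) := by
        rw [Finset.sum_comm]
        refine Finset.sum_le_sum fun v _ => ?_
        have := enon (n + 1) v
        simp only [he] at this
        linarith
      rw [Finset.sum_range_succ', ha, sum_arriveProb_zero, Finset.sum_add_distrib, h.pi_sum] at h3
      linarith
    have h3 : 0 ≤ (n : ℝ) * ∑ y, arriveProb P s Γ n y :=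
      mul_nonneg (Nat.cast_nonneg _) (Finset.sum_nonneg fun y _ => anon n y)
    linarith

/-- The access time of `π` is at most the sum of a hitting time for the chain and a hitting time for
its reversal. -/
lemma IsUniformFlow.tStop_le (h : IsUniformFlow G P π K) {o : V} {g g' : V → ℝ}
    (hg : IsHittingTime P o g) (hg' : IsHittingTime (reversal P π) o g') {M : ℝ}
    (hM : ∀ x, g x ≤ M) (hM' : ∀ x, g' x ≤ M) : tStop P π ≤ ENNReal.ofReal (2 * M) := by
  refine iSup_le fun s => ?_
  have hr := h.reversed
  have hS : ∃ z, z ∉ (Finset.univ.erase o : Finset V) := ⟨o, by simp⟩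
  -- With this right-hand side, `π v * f v` is the expected number of visits to `v` by the forward
  -- chain from `s` before it hits `o`.
  set b : V → ℝ := fun x => if x = s then 1 / π s else 0 with hb
  have bnon : ∀ x, 0 ≤ b x := fun x => by
    simp only [hb]; split_ifs
    · exact one_div_nonneg.2 (h.pi_pos s).le
    · exact le_rfl
  obtain ⟨f, hf0, hf⟩ := hr.exists_dirichlet hS b
  have hfn := hr.nonneg_of_dirichlet hS bnon hf0 hf
  have hfo : f o = 0 := hf0 o (by simp)
  have hfe : ∀ x, x ≠ o → f x = b x + ∑ y, reversal P π x y * f y := fun x hx => hf x (by simp [hx])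
  have rev : ∀ u v, π v * reversal P π v u = π u * P u v := fun u v => by
    have := (h.pi_pos v).ne'
    simp only [reversal]; field_simp
  have revsum : ∀ (k : V → ℝ) v, ∑ u, π u * k u * P u v = π v * ∑ u, reversal P π v u * k u := by
    intro k v
    rw [Finset.mul_sum]
    refine Finset.sum_congr rfl fun u _ => ?_
    rw [← mul_assoc, rev]; ring
  -- the Laplacian of `f`
  have fall : ∀ v, π v * (f v - ∑ u, reversal P π v u * f u) =
      (if v = s then 1 else 0) - if v = o then 1 else 0 := by
    intro v
    by_cases hv : v = o
    · subst hv
      have h1 := hr.laplacian_at_root hfe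
      have h2 : ∑ x ∈ Finset.univ.erase v, π x * b x = if v = s then 0 else 1 := by
        simp only [hb, mul_ite, mul_zero]
        rw [Finset.sum_ite_eq']
        have := (h.pi_pos s).ne'
        by_cases hvs : v = s
        · simp [hvs]
        · have : s ≠ v := fun e => hvs e.symm
          simp [hvs, this]
          field_simp
      rw [h2] at h1
      rw [if_pos rfl]
      split_ifs at h1 ⊢ <;> linarith
    · rw [if_neg hv, sub_zero]
      nth_rewrite 1 [hfe v hv]
      rw [add_sub_cancel_right]
      simp only [hb]
      split_ifs with hvs
      · subst hvs
        have := (h.pi_pos v).ne'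
        field_simp
      · simp
  have gall : ∀ v, π v * (g' v - ∑ u, reversal P π v u * g' u) =
      π v - if v = o then 1 else 0 := by
    intro v
    by_cases hv : v = o
    · subst hv
      have := hg'.at_root hr
      rw [this, hg'.root, if_pos rfl]
      have := (h.pi_pos v).ne'
      field_simp; ring
    · rw [if_neg hv]
      nth_rewrite 1 [hg'.eqn v hv]
      ring
  -- Exit frequencies of a concatenated rule: `π * f` for running from `s` until `o` is hit, then `π
  -- * (M - g')` for going from `o` to `π`. The upper bound `M` on `g'` makes the second part
  -- nonnegative.
  set x : V → ℝ := fun v => π v * (f v + (M - g' v)) with hx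
  have hxn : ∀ v, 0 ≤ x v := fun v =>
    mul_nonneg (h.pi_pos v).le (add_nonneg (hfn v) (sub_nonneg.2 (hM' v)))
  have hxP : ∀ v, x v = (if v = s then 1 else 0) - π v + ∑ u, x u * P u v := by
    intro v
    simp only [hx]
    rw [revsum]
    have : ∑ u, reversal P π v u * (f u + (M - g' u)) =
        ∑ u, reversal P π v u * f u + M - ∑ u, reversal P π v u * g' u := by
      simp only [mul_add, mul_sub, Finset.sum_add_distrib, Finset.sum_sub_distrib]
      rw [← Finset.sum_mul, hr.row_sum]; ring
    rw [this]
    linarith [fall v, gall v]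
  obtain ⟨Γ, hΓ, hE⟩ := h.exists_rule s hxn hxP
  refine (iInf_le_of_le Γ (iInf_le_of_le hΓ hE)).trans (ENNReal.ofReal_le_ofReal ?_)
  -- total mass of `f` by duality with `g`
  have fmass : ∑ v, π v * f v = g s := by
    have h1 : ∑ v, π v * (f v - ∑ u, reversal P π v u * f u) * g v = g s := by
      simp only [fall, sub_mul, Finset.sum_sub_distrib, ite_mul, one_mul, zero_mul]
      simp [hg.root]
    rw [← h1]
    have h2 : ∑ v, π v * (∑ u, reversal P π v u * f u) * g v =
        ∑ u, π u * f u * ∑ v, P u v * g v := by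
      simp only [← revsum, Finset.sum_mul, Finset.mul_sum]
      rw [Finset.sum_comm]
      exact Finset.sum_congr rfl fun u _ => Finset.sum_congr rfl fun v _ => by ring
    simp only [mul_sub, sub_mul, Finset.sum_sub_distrib]
    rw [h2, ← Finset.sum_sub_distrib]
    refine Finset.sum_congr rfl fun v _ => ?_
    by_cases hv : v = o
    · subst hv; simp [hfo]
    · nth_rewrite 1 [hg.eqn v hv]; ring
  have : ∑ v, x v = g s + (M - ∑ v, π v * g' v) := by
    simp only [hx, mul_add, mul_sub, Finset.sum_add_distrib, Finset.sum_sub_distrib]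
    rw [fmass, ← Finset.sum_mul, h.pi_sum, one_mul]
  have hpos : 0 ≤ ∑ v, π v * g' v :=
    Finset.sum_nonneg fun v _ => mul_nonneg (h.pi_pos v).le (hg'.nonneg v)
  linarith [hM s]

/-- Weak duality: a test function with Laplacian at most one bounds access times from below. -/
lemma IsUniformFlow.le_tStop (h : IsUniformFlow G P π K) {g : V → ℝ}
    (hg : ∀ x, g x ≤ 1 + ∑ y, P x y * g y) (s : V) :
    ENNReal.ofReal (g s - ∑ x, π x * g x) ≤ tStop P π := by
  refine le_iSup_of_le s (le_iInf fun Γ => le_iInf fun hΓ => ?_)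
  by_cases htop : expectedTime P s Γ = ⊤
  · rw [htop]; exact le_top
  set a := arriveProb P s Γ with ha
  set σ := stopAtProb P s Γ with hσ
  have snon : ∀ k y, 0 ≤ σ k y := stopAtProb_nonneg h.nonneg s Γ
  have tnon : ∀ k, 0 ≤ ∑ y, σ k y := fun k => Finset.sum_nonneg fun y _ => snon k y
  have key : ∀ k : ℕ, (k : ℝ≥0∞) * ENNReal.ofReal (∑ y, σ k y) =
      ENNReal.ofReal (k * ∑ y, σ k y) := fun k => by
    rw [ENNReal.ofReal_mul (Nat.cast_nonneg _), ENNReal.ofReal_natCast]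
  have hE : expectedTime P s Γ = ∑' k : ℕ, ENNReal.ofReal (k * ∑ y, σ k y) := tsum_congr key
  have knon : ∀ k : ℕ, 0 ≤ (k : ℝ) * ∑ y, σ k y := fun k => mul_nonneg (Nat.cast_nonneg _) (tnon k)
  have hsum : Summable fun k : ℕ => (k : ℝ) * ∑ y, σ k y := by
    have := ENNReal.summable_toReal (hE ▸ htop)
    refine this.congr fun k => ENNReal.toReal_ofReal (knon k)
  rw [hE, ← ENNReal.ofReal_tsum_of_nonneg knon hsum]
  refine ENNReal.ofReal_le_ofReal ?_
  set E := ∑' k : ℕ, (k : ℝ) * ∑ y, σ k y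
  have htot : HasSum (fun k => ∑ y, σ k y) 1 := by
    rw [← h.pi_sum]
    exact hasSum_sum fun y _ => hΓ y
  obtain ⟨m, hm⟩ := let _ := h.nontrivial; Finite.exists_max g
  -- the mass not yet stopped at time `n`
  have tail : ∀ n : ℕ, (n : ℝ) * ∑ y, a n y ≤ E - ∑ k ∈ Finset.range n, (k : ℝ) * ∑ y, σ k y := by
    intro n
    rw [ha, sum_arriveProb_eq h.row_sum]
    have h1 : HasSum (fun k => ∑ y, σ (k + n) y) (1 - ∑ k ∈ Finset.range n, ∑ y, σ k y) :=
      (hasSum_nat_add_iff' n).2 htot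
    have h2 : HasSum (fun k : ℕ => ((k + n : ℕ) : ℝ) * ∑ y, σ (k + n) y)
        (E - ∑ k ∈ Finset.range n, (k : ℝ) * ∑ y, σ k y) :=
      (hasSum_nat_add_iff' n).2 hsum.hasSum
    refine hasSum_le (fun k => ?_) (h1.mul_left (n : ℝ)) h2
    refine mul_le_mul_of_nonneg_right ?_ (tnon _)
    push_cast
    linarith [Nat.cast_nonneg (α := ℝ) k]
  -- Optional stopping at `min(τ, n)`: the sums are the contribution of `g` where the rule has
  -- stopped, `𝔼[min(τ, n)]`, and the contribution of the mass alive at time `n`. The last is at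
  -- most `max g` times a vanishing mass.
  have main : ∀ n : ℕ, g s ≤ ∑ k ∈ Finset.range n, ∑ y, σ k y * g y +
      ∑ k ∈ Finset.range n, ∑ y, a (k + 1) y + ∑ y, a n y * g y := by
    intro n
    induction n with
    | zero => simp [ha, arriveProb_zero]
    | succ n ih =>
      have h1 : ∑ y, a (n + 1) y * g y = ∑ z, (a n z - σ n z) * ∑ y, P z y * g y := by
        simp only [ha, arriveProb_succ, Finset.sum_mul, Finset.mul_sum]
        rw [Finset.sum_comm]
        exact Finset.sum_congr rfl fun u _ => Finset.sum_congr rfl fun v _ => by ring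
      have h2 : ∑ z, (a n z - σ n z) * (g z - 1) ≤ ∑ y, a (n + 1) y * g y := by
        rw [h1]
        refine Finset.sum_le_sum fun z _ => mul_le_mul_of_nonneg_left (by linarith [hg z]) ?_
        exact sub_nonneg.2 (stopAtProb_le_arriveProb h.nonneg s Γ n z)
      have h3 : ∑ z, (a n z - σ n z) * (g z - 1) =
          ∑ y, a n y * g y - ∑ y, σ n y * g y - ∑ y, a (n + 1) y := by
        rw [ha, sum_arriveProb_succ h.row_sum s Γ n]
        simp only [← Finset.sum_sub_distrib]
        exact Finset.sum_congr rfl fun z _ => by ring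
      rw [Finset.sum_range_succ, Finset.sum_range_succ]
      linarith
  have bound : ∀ n : ℕ, g s - E - ∑ k ∈ Finset.range n, ∑ y, σ k y * g y ≤
      g m * (1 - ∑ k ∈ Finset.range n, ∑ y, σ k y) := by
    intro n
    have h1 := main n
    have h2 := sum_range_sum_arriveProb h.row_sum s Γ n
    have h3 := tail n
    have h4 : ∑ y, a n y * g y ≤ g m * ∑ y, a n y := by
      rw [Finset.mul_sum]
      refine Finset.sum_le_sum fun y _ => ?_
      rw [mul_comm]
      exact mul_le_mul_of_nonneg_right (hm y) (arriveProb_nonneg h.nonneg s Γ n y)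
    rw [ha, sum_arriveProb_eq h.row_sum] at h4
    linarith
  have l1 : Filter.Tendsto (fun n => ∑ k ∈ Finset.range n, ∑ y, σ k y * g y) Filter.atTop
      (nhds (∑ y, π y * g y)) :=
    (hasSum_sum fun y _ => (hΓ y).mul_right (g y)).tendsto_sum_nat
  have l2 := htot.tendsto_sum_nat
  have := le_of_tendsto_of_tendsto' (l1.const_sub (g s - E)) ((l2.const_sub 1).const_mul (g m))
    bound
  simp only [sub_self, mul_zero] at this
  linarith

end Stopping

/-! ### Mixing times and hitting times -/

section Mixing

variable {V : Type u} [Fintype V] {G : SimpleGraph V} {P : Matrix V V ℝ} {π : V → ℝ} {K : ℝ}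

namespace IsUniformFlow

lemma sum_pi_mulVec_mul (hr : IsReversible P π) (f g : V → ℝ) :
    ∑ x, π x * (P.mulVec f x * g x) = ∑ x, π x * (f x * P.mulVec g x) := by
  simp only [Matrix.mulVec, dotProduct, Finset.mul_sum, Finset.sum_mul]
  rw [Finset.sum_comm]
  refine Finset.sum_congr rfl fun x _ => Finset.sum_congr rfl fun y _ => ?_
  have := hr x y
  calc π y * (P y x * f x * g y) = (π y * P y x) * (f x * g y) := by ring
    _ = (π x * P x y) * (f x * g y) := by rw [this]
    _ = _ := by ring

/-- Jensen's inequality in each row, in the form that a variance is nonnegative, followed by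
stationarity. -/
lemma sum_pi_mulVec_sq_le (h : IsUniformFlow G P π K) (f : V → ℝ) :
    ∑ x, π x * P.mulVec f x ^ 2 ≤ ∑ x, π x * f x ^ 2 := by
  rw [← h.sum_pi_mul_sum fun x => f x ^ 2]
  refine Finset.sum_le_sum fun x _ => mul_le_mul_of_nonneg_left ?_ (h.pi_pos x).le
  set m := P.mulVec f x with hm
  have h0 : 0 ≤ ∑ y, P x y * (f y - m) ^ 2 :=
    Finset.sum_nonneg fun y _ => mul_nonneg (h.nonneg _ _) (sq_nonneg _)
  have h1 : ∑ y, P x y * (f y - m) ^ 2 =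
      ∑ y, P x y * f y ^ 2 - 2 * m * ∑ y, P x y * f y + m ^ 2 * ∑ y, P x y := by
    simp only [Finset.mul_sum]
    rw [← Finset.sum_sub_distrib, ← Finset.sum_add_distrib]
    exact Finset.sum_congr rfl fun y _ => by ring
  have h2 : ∑ y, P x y * f y = m := rfl
  rw [h1, h.row_sum, h2] at h0
  nlinarith

/-- The sum of `π x * P x y * (f x + f y) ^ 2` equals `2‖f‖² + 2⟨Pf, f⟩`, and by laziness its
diagonal terms alone already give `2‖f‖²`. -/
lemma sum_pi_mulVec_mul_self_nonneg (h : IsUniformFlow G P π K) (hl : ∀ x, P x x = 1 / 2)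
    (f : V → ℝ) : 0 ≤ ∑ x, π x * (P.mulVec f x * f x) := by
  have h1 : ∑ x, π x * (2 * f x ^ 2) ≤ ∑ x, π x * ∑ y, P x y * (f x + f y) ^ 2 := by
    refine Finset.sum_le_sum fun x _ => mul_le_mul_of_nonneg_left ?_ (h.pi_pos x).le
    have := Finset.single_le_sum (f := fun y => P x y * (f x + f y) ^ 2)
      (fun y _ => mul_nonneg (h.nonneg x y) (sq_nonneg _)) (Finset.mem_univ x)
    simp only [hl] at this
    linarith
  have h2 : ∀ x, π x * ∑ y, P x y * (f x + f y) ^ 2 =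
      π x * f x ^ 2 + π x * ∑ y, P x y * f y ^ 2 + 2 * (π x * (P.mulVec f x * f x)) := by
    intro x
    have : ∑ y, P x y * (f x + f y) ^ 2 =
        f x ^ 2 * ∑ y, P x y + ∑ y, P x y * f y ^ 2 + 2 * f x * ∑ y, P x y * f y := by
      simp only [Finset.mul_sum]
      rw [← Finset.sum_add_distrib, ← Finset.sum_add_distrib]
      exact Finset.sum_congr rfl fun y _ => by ring
    rw [this, h.row_sum]
    simp only [Matrix.mulVec, dotProduct]; ring
  simp only [h2, Finset.sum_add_distrib] at h1
  rw [h.sum_pi_mul_sum, ← Finset.mul_sum] at h1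
  have h3 : ∑ x, π x * (2 * f x ^ 2) = 2 * ∑ x, π x * f x ^ 2 := by
    rw [Finset.mul_sum]; exact Finset.sum_congr rfl fun y _ => by ring
  rw [h3] at h1
  linarith

variable [DecidableEq V]

lemma pow_nonneg (h : IsUniformFlow G P π K) (n : ℕ) (x y : V) : 0 ≤ (P ^ n) x y := by
  induction n generalizing y with
  | zero => rw [pow_zero, Matrix.one_apply]; split_ifs <;> norm_num
  | succ n ih =>
    rw [pow_succ, Matrix.mul_apply]
    exact Finset.sum_nonneg fun z _ => mul_nonneg (ih z) (h.nonneg z y)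

lemma pow_row_sum (h : IsUniformFlow G P π K) (n : ℕ) (x : V) : ∑ y, (P ^ n) x y = 1 := by
  induction n with
  | zero => simp [Matrix.one_apply]
  | succ n ih =>
    simp only [pow_succ, Matrix.mul_apply]
    rw [Finset.sum_comm]
    simp [← Finset.mul_sum, h.row_sum, ih]

lemma _root_.MarkovRI.sum_mul_pow_of_stationary (h : ∀ y, ∑ x, π x * P x y = π y) (n : ℕ)
    (y : V) : ∑ x, π x * (P ^ n) x y = π y := by
  induction n generalizing y with
  | zero => simp [Matrix.one_apply]
  | succ n ih =>
    simp only [pow_succ, Matrix.mul_apply, Finset.mul_sum]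
    rw [Finset.sum_comm]
    simp only [← mul_assoc, ← Finset.sum_mul, ih, h]

lemma mulVec_pow_succ (P : Matrix V V ℝ) (n : ℕ) (f : V → ℝ) (x : V) :
    (P ^ (n + 1)).mulVec f x = ∑ y, P x y * (P ^ n).mulVec f y := by
  rw [pow_succ', ← Matrix.mulVec_mulVec]; rfl

/-- The `ℓ¹` distance to stationarity halves over every period by which the total variation distance
is at most `1/4`. -/
lemma sum_abs_pow_mul_le (h : IsUniformFlow G P π K) {t : ℕ}
    (ht : ∀ x, tvDist (fun y => (P ^ t) x y) π ≤ 1 / 4) (k : ℕ) (x : V) :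
    ∑ y, |(P ^ (t * k)) x y - π y| ≤ 2 * (1 / 2) ^ k := by
  have tv : ∀ x (A : Finset V), |∑ y ∈ A, (P ^ t) x y - ∑ y ∈ A, π y| ≤ 1 / 4 := fun x A =>
    (le_ciSup (f := fun A : Finset V => |∑ y ∈ A, (P ^ t) x y - ∑ y ∈ A, π y|)
      (Set.finite_range _).bddAbove A).trans (ht x)
  have l1 : ∀ x, ∑ y, |(P ^ t) x y - π y| ≤ 1 / 2 := by
    intro x
    rw [← Finset.sum_filter_add_sum_filter_not Finset.univ (fun y => 0 ≤ (P ^ t) x y - π y)]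
    have h1 := tv x (Finset.univ.filter fun y => 0 ≤ (P ^ t) x y - π y)
    have h2 := tv x (Finset.univ.filter fun y => ¬ 0 ≤ (P ^ t) x y - π y)
    rw [← Finset.sum_sub_distrib] at h1 h2
    have e1 : ∑ y with 0 ≤ (P ^ t) x y - π y, |(P ^ t) x y - π y| =
        ∑ y with 0 ≤ (P ^ t) x y - π y, ((P ^ t) x y - π y) :=
      Finset.sum_congr rfl fun y hy => abs_of_nonneg (Finset.mem_filter.1 hy).2
    have e2 : ∑ y with ¬ 0 ≤ (P ^ t) x y - π y, |(P ^ t) x y - π y| =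
        - ∑ y with ¬ 0 ≤ (P ^ t) x y - π y, ((P ^ t) x y - π y) := by
      rw [← Finset.sum_neg_distrib]
      exact Finset.sum_congr rfl fun y hy =>
        abs_of_neg (not_le.1 (Finset.mem_filter.1 hy).2)
    rw [e1, e2]
    linarith [(abs_le.1 h1).2, (abs_le.1 h2).1]
  induction k generalizing x with
  | zero =>
    calc ∑ y, |(P ^ (t * 0)) x y - π y| ≤ ∑ y, ((P ^ (t * 0)) x y + π y) := by
          refine Finset.sum_le_sum fun y _ => abs_le.2 ⟨?_, ?_⟩
          · linarith [h.pow_nonneg (t * 0) x y]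
          · linarith [h.pi_pos y]
      _ ≤ _ := by rw [Finset.sum_add_distrib, h.pow_row_sum, h.pi_sum]; norm_num
  | succ k ih =>
    -- With `Π` the matrix all of whose rows are `π`, this is `P^(t(k+1)) - Π = (P^(tk) - Π)(P^t -
    -- Π)`. The second factor has row norms at most `1/2`.
    have e : ∀ y, (P ^ (t * (k + 1))) x y - π y =
        ∑ z, ((P ^ (t * k)) x z - π z) * ((P ^ t) z y - π y) := by
      intro y
      have h1 : ∑ z, ((P ^ (t * k)) x z - π z) * π y = 0 := by
        rw [← Finset.sum_mul, Finset.sum_sub_distrib, h.pow_row_sum, h.pi_sum]; ring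
      simp only [mul_sub, Finset.sum_sub_distrib]
      rw [h1, mul_add, mul_one, pow_add, Matrix.mul_apply]
      simp only [sub_mul, Finset.sum_sub_distrib]
      rw [sum_mul_pow_of_stationary h.stationary]; ring
    calc ∑ y, |(P ^ (t * (k + 1))) x y - π y|
        ≤ ∑ y, ∑ z, |(P ^ (t * k)) x z - π z| * |(P ^ t) z y - π y| := by
          refine Finset.sum_le_sum fun y _ => ?_
          rw [e]
          refine (Finset.abs_sum_le_sum_abs _ _).trans (le_of_eq ?_)
          exact Finset.sum_congr rfl fun z _ => abs_mul _ _
      _ = ∑ z, |(P ^ (t * k)) x z - π z| * ∑ y, |(P ^ t) z y - π y| := by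
          rw [Finset.sum_comm]; simp only [Finset.mul_sum]
      _ ≤ ∑ z, |(P ^ (t * k)) x z - π z| * (1 / 2) :=
          Finset.sum_le_sum fun z _ => mul_le_mul_of_nonneg_left (l1 z) (abs_nonneg _)
      _ = (∑ z, |(P ^ (t * k)) x z - π z|) * (1 / 2) := by rw [Finset.sum_mul]
      _ ≤ (2 * (1 / 2) ^ k) * (1 / 2) := mul_le_mul_of_nonneg_right (ih x) (by norm_num)
      _ = _ := by rw [pow_succ]; ring

/-- Escaping from a set whose complement has mass at least `c` bounds the mixing time from below. -/
lemma le_tMix (h : IsUniformFlow G P π K) {g : V → ℝ} {S : Finset V} {c : ℝ}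
    (hg0 : ∀ x, 0 ≤ g x) (hgS : ∀ x ∉ S, g x = 0)
    (hg : ∀ x, g x ≤ 1 + ∑ y, P x y * g y) (hS : ∑ x ∈ S, π x ≤ 1 - c) {k : ℕ} (hk0 : 0 < k)
    (hk : 2 * (1 / 2 : ℝ) ^ k ≤ c / 2) (s : V) :
    ENNReal.ofReal (c / (2 * k) * g s) ≤ tMix P π := by
  refine le_iInf fun t => le_iInf fun ht => ?_
  rw [← ENNReal.ofReal_natCast]
  refine ENNReal.ofReal_le_ofReal ?_
  have := h.nontrivial
  obtain ⟨m, hm⟩ := Finite.exists_max g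
  have iter : ∀ (n : ℕ) x, g x ≤ n + (P ^ n).mulVec g x := by
    intro n
    induction n with
    | zero => intro x; simp
    | succ n ih =>
      intro x
      rw [mulVec_pow_succ]
      have : ∑ y, P x y * g y ≤ ∑ y, P x y * (n + (P ^ n).mulVec g y) :=
        Finset.sum_le_sum fun y _ => mul_le_mul_of_nonneg_left (ih y) (h.nonneg _ _)
      simp only [mul_add, Finset.sum_add_distrib] at this
      rw [← Finset.sum_mul, h.row_sum] at this
      push_cast
      linarith [hg x]
  have h1 := iter (t * k) m
  have h2 := h.sum_abs_pow_mul_le ht k m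
  -- After `t * k` steps the chance of being in `S` is at most `1 - c` plus an error at most `c /
  -- 2`. Taken at a maximiser of `g`, the iterated inequality then gives `c / 2 * g m ≤ t * k`.
  have h3 : (P ^ (t * k)).mulVec g m ≤ g m * (1 - c / 2) := by
    calc (P ^ (t * k)).mulVec g m = ∑ y, (P ^ (t * k)) m y * g y := rfl
      _ = ∑ y ∈ S, (P ^ (t * k)) m y * g y := by
          refine (Finset.sum_subset (Finset.subset_univ S) fun y _ hy => ?_).symm
          rw [hgS y hy, mul_zero]
      _ ≤ ∑ y ∈ S, (P ^ (t * k)) m y * g m :=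
          Finset.sum_le_sum fun y _ =>
            mul_le_mul_of_nonneg_left (hm y) (h.pow_nonneg _ _ _)
      _ = g m * ∑ y ∈ S, (P ^ (t * k)) m y := by rw [← Finset.sum_mul, mul_comm]
      _ ≤ g m * ∑ y ∈ S, (π y + |(P ^ (t * k)) m y - π y|) := by
          refine mul_le_mul_of_nonneg_left (Finset.sum_le_sum fun y _ => ?_) (hg0 m)
          linarith [le_abs_self ((P ^ (t * k)) m y - π y)]
      _ ≤ g m * (1 - c / 2) := by
          refine mul_le_mul_of_nonneg_left ?_ (hg0 m)
          rw [Finset.sum_add_distrib]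
          have : ∑ y ∈ S, |(P ^ (t * k)) m y - π y| ≤ ∑ y, |(P ^ (t * k)) m y - π y| :=
            Finset.sum_le_sum_of_subset_of_nonneg (Finset.subset_univ S) fun y _ _ => abs_nonneg _
          linarith
  have hc : 0 < c := by
    have : (0 : ℝ) < (1 / 2) ^ k := by positivity
    linarith
  have hkR : (0 : ℝ) < k := by exact_mod_cast hk0
  have h4 : c / 2 * g m ≤ t * k := by push_cast at h1; nlinarith
  have h5 : c / 2 * g s ≤ t * k :=
    (mul_le_mul_of_nonneg_left (hm s) (by linarith)).trans h4
  have h6 : c / (2 * k) * g s = c / 2 * g s / k := by field_simp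
  rw [h6, div_le_iff₀ hkR]
  exact h5

/-- Upper tails of the hitting time, by Markov's inequality. -/
lemma exists_tail (h : IsUniformFlow G P π K) {o : V} {g : V → ℝ} (hg : IsHittingTime P o g) :
    ∃ q : ℕ → V → ℝ, (∀ n, q n o = 0) ∧ (∀ x, x ≠ o → q 0 x = 1) ∧
      (∀ n x, x ≠ o → q (n + 1) x = ∑ y, P x y * q n y) ∧ ∀ n x, (n + 1) * q n x ≤ g x := by
  -- `q n x` is the probability, from `x`, that `o` has not been visited by time `n`, time `0`
  -- included.
  let q : ℕ → V → ℝ := fun n => Nat.rec (fun x => if x = o then 0 else 1)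
    (fun _ f x => if x = o then 0 else ∑ y, P x y * f y) n
  have q0 : ∀ x, q 0 x = if x = o then 0 else 1 := fun _ => rfl
  have q1 : ∀ n x, q (n + 1) x = if x = o then 0 else ∑ y, P x y * q n y := fun _ _ => rfl
  have qo : ∀ n, q n o = 0 := fun n => by
    cases n with
    | zero => simp [q0]
    | succ n => simp [q1]
  have anti : ∀ n x, q (n + 1) x ≤ q n x := by
    intro n
    induction n with
    | zero =>
      intro x
      rw [q1, q0]
      split_ifs
      · exact le_rfl
      · rw [← h.row_sum x]
        refine Finset.sum_le_sum fun y _ => mul_le_of_le_one_right (h.nonneg _ _) ?_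
        rw [q0]; split_ifs <;> norm_num
    | succ n ih =>
      intro x
      rw [q1 (n + 1) x, q1 n x]
      split_ifs
      · exact le_rfl
      · exact Finset.sum_le_sum fun y _ => mul_le_mul_of_nonneg_left (ih y) (h.nonneg _ _)
  have sums : ∀ n x, ∑ j ∈ Finset.range n, q j x ≤ g x := by
    intro n
    induction n with
    | zero => intro x; simpa using hg.nonneg x
    | succ n ih =>
      intro x
      by_cases hx : x = o
      · subst hx; simp [qo, hg.root]
      · rw [Finset.sum_range_succ', q0, if_neg hx, hg.eqn x hx]
        have : ∑ j ∈ Finset.range n, q (j + 1) x =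
            ∑ y, P x y * ∑ j ∈ Finset.range n, q j y := by
          simp only [q1, if_neg hx, Finset.mul_sum]
          rw [Finset.sum_comm]
        rw [this, add_comm]
        have := Finset.sum_le_sum fun y (_ : y ∈ Finset.univ) =>
          mul_le_mul_of_nonneg_left (ih y) (h.nonneg x y)
        linarith
  have mono : ∀ x, Antitone fun n => q n x := fun x => antitone_nat_of_succ_le fun n => anti n x
  refine ⟨q, qo, fun x hx => by rw [q0, if_neg hx], fun n x hx => by rw [q1, if_neg hx],
    fun n x => ?_⟩
  refine le_trans ?_ (sums (n + 1) x)
  have := Finset.card_nsmul_le_sum (Finset.range (n + 1)) (fun j => q j x) (q n x)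
    fun j hj => mono x (by have := Finset.mem_range.1 hj; omega)
  simpa using this

section Reversible

lemma sum_pi_pow_mulVec_mul (hr : IsReversible P π) (n : ℕ) (f g : V → ℝ) :
    ∑ x, π x * ((P ^ n).mulVec f x * g x) = ∑ x, π x * (f x * (P ^ n).mulVec g x) := by
  induction n generalizing f with
  | zero => simp
  | succ n ih =>
    rw [pow_succ, ← Matrix.mulVec_mulVec, ih, sum_pi_mulVec_mul hr]
    rw [Matrix.mulVec_mulVec, ← pow_succ, pow_succ']

lemma sum_pi_pow_mulVec (h : IsUniformFlow G P π K) (n : ℕ) (f : V → ℝ) :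
    ∑ x, π x * (P ^ n).mulVec f x = ∑ x, π x * f x := by
  induction n with
  | zero => simp
  | succ n ih => simp only [mulVec_pow_succ]; rw [h.sum_pi_mul_sum, ih]

/-- The centred density of the point mass at `o` decays in `L²` at a rate governed by the hitting
time of `o`. -/
lemma mul_sum_pi_sq_le (h : IsUniformFlow G P π K) (hr : IsReversible P π)
    (hl : ∀ x, P x x = 1 / 2) {o : V} {g : V → ℝ} (hg : IsHittingTime P o g) {H : ℝ}
    (hH : ∀ x, g x ≤ H) (N : ℕ) :
    N * ∑ x, π x * (P ^ N).mulVec (fun x => (if x = o then 1 / π o else 0) - 1) x ^ 2 ≤ H := by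
  set w : V → ℝ := fun x => (if x = o then 1 / π o else 0) - 1 with hw
  have pairing : ∀ f : V → ℝ, ∑ x, π x * (f x * w x) = f o - ∑ x, π x * f x := by
    intro f
    have hpo := (h.pi_pos o).ne'
    simp only [hw, mul_sub, Finset.sum_sub_distrib, mul_ite, mul_zero, mul_one]
    rw [Finset.sum_ite_eq' Finset.univ o, if_pos (Finset.mem_univ o)]
    field_simp
  have meanw : ∑ x, π x * w x = 0 := by
    have := pairing (fun _ => 1)
    simpa [h.pi_sum] using this
  -- Kac's formula supplies the case `x = o`. Since `w = P g - g` and `g o = 0`, the sums of `P^k w`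
  -- at `o` telescope to `P^n g` at `o`, which is at most `H`.
  have weq : ∀ x, w x = ∑ y, P x y * g y - g x := by
    intro x
    by_cases hx : x = o
    · subst hx; simp [hw, hg.at_root h, hg.root]
    · simp only [hw, if_neg hx]; linarith [hg.eqn x hx]
  have tele : ∀ n, ∑ k ∈ Finset.range n, (P ^ k).mulVec w o = (P ^ n).mulVec g o := by
    intro n
    induction n with
    | zero => simp [hg.root]
    | succ n ih =>
      have e : w = P.mulVec g - g := funext weq
      rw [Finset.sum_range_succ, ih, e, Matrix.mulVec_sub, Matrix.mulVec_mulVec, ← pow_succ]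
      simp
  set D : ℕ → ℝ := fun k => ∑ x, π x * (P ^ k).mulVec w x ^ 2 with hD
  -- Pairing a mean-zero function with `w` evaluates it at `o`; self-adjointness moves powers
  -- across. Hence `P^(2k) w` at `o` is the squared norm `D k`, while odd powers are nonnegative by
  -- laziness. As `D` decreases, `N * D N` is at most the telescoped sum.
  have hval : ∀ k j, ∑ x, π x * ((P ^ k).mulVec w x * (P ^ j).mulVec w x) =
      (P ^ (k + j)).mulVec w o := by
    intro k j
    have h1 := sum_pi_pow_mulVec_mul hr k ((P ^ j).mulVec w) w
    rw [pairing, h.sum_pi_pow_mulVec, h.sum_pi_pow_mulVec, meanw, sub_zero, Matrix.mulVec_mulVec,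
      ← pow_add] at h1
    rw [h1]
    exact Finset.sum_congr rfl fun x _ => by ring
  have even : ∀ k, (P ^ (k + k)).mulVec w o = D k := fun k => by
    rw [← hval]; exact Finset.sum_congr rfl fun x _ => by ring
  have odd : ∀ k, 0 ≤ (P ^ (k + k + 1)).mulVec w o := fun k => by
    have := h.sum_pi_mulVec_mul_self_nonneg hl ((P ^ k).mulVec w)
    rw [Matrix.mulVec_mulVec, ← pow_succ', hval] at this
    rwa [show k + k + 1 = k + 1 + k by ring]
  have anti : Antitone D := antitone_nat_of_succ_le fun n => by
    have := h.sum_pi_mulVec_sq_le ((P ^ n).mulVec w)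
    rwa [Matrix.mulVec_mulVec, ← pow_succ'] at this
  have low : ∀ n, ∑ k ∈ Finset.range n, D k ≤ ∑ k ∈ Finset.range (n + n), (P ^ k).mulVec w o := by
    intro n
    induction n with
    | zero => simp
    | succ n ih =>
      rw [show n + 1 + (n + 1) = n + n + 1 + 1 by ring, Finset.sum_range_succ,
        Finset.sum_range_succ, Finset.sum_range_succ, even]
      linarith [odd n]
  have top : (P ^ (N + N)).mulVec g o ≤ H := by
    calc (P ^ (N + N)).mulVec g o = ∑ y, (P ^ (N + N)) o y * g y := rfl
      _ ≤ ∑ y, (P ^ (N + N)) o y * H :=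
          Finset.sum_le_sum fun y _ => mul_le_mul_of_nonneg_left (hH y) (h.pow_nonneg _ _ _)
      _ = H := by rw [← Finset.sum_mul, h.pow_row_sum, one_mul]
  have := Finset.card_nsmul_le_sum (Finset.range N) D (D N)
    fun j hj => anti (Finset.mem_range.1 hj).le
  rw [Finset.card_range, nsmul_eq_mul] at this
  linarith [low N, tele (N + N)]

/-- A reversible lazy chain mixes within a constant times the maximal hitting time of any vertex. -/
lemma tMix_le (h : IsUniformFlow G P π K) (hr : IsReversible P π) (hl : ∀ x, P x x = 1 / 2)
    {o : V} {g : V → ℝ} (hg : IsHittingTime P o g) {H : ℝ} (hH : ∀ x, g x ≤ H) :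
    tMix P π ≤ ENNReal.ofReal (74 * H) := by
  have hH1 : 1 ≤ H := by
    obtain ⟨x, hx⟩ := h.exists_adj o
    have h1 := hg.eqn x hx.ne'
    have : 0 ≤ ∑ y, P x y * g y :=
      Finset.sum_nonneg fun y _ => mul_nonneg (h.nonneg _ _) (hg.nonneg y)
    linarith [hH x]
  obtain ⟨q, qo, q0, q1, qg⟩ := h.exists_tail hg
  -- After `64 * H` steps from `o` the `L²` bound is `1/64`, giving error `1/8`. By time `8 * H` the
  -- chance of not having hit `o` is at most `1/8`. The two ceilings cost at most `2 ≤ 2 * H`,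
  -- whence `74`.
  set k := ⌈64 * H⌉₊ with hk
  set n := ⌈8 * H⌉₊ with hn
  have hk1 : 64 * H ≤ k := Nat.le_ceil _
  have hn1 : 8 * H ≤ n := Nat.le_ceil _
  have hk2 : (k : ℝ) < 64 * H + 1 := Nat.ceil_lt_add_one (by linarith)
  have hn2 : (n : ℝ) < 8 * H + 1 := Nat.ceil_lt_add_one (by linarith)
  refine iInf_le_of_le (k + n) (iInf_le_of_le (fun x => ciSup_le fun A => ?_) ?_)
  swap
  · rw [← ENNReal.ofReal_natCast]
    refine ENNReal.ofReal_le_ofReal ?_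
    push_cast
    linarith
  set φ : V → ℝ := fun y => (if y ∈ A then 1 else 0) - ∑ z ∈ A, π z with hφ
  have e : ∑ y ∈ A, (P ^ (k + n)) x y - ∑ y ∈ A, π y = (P ^ (k + n)).mulVec φ x := by
    simp only [Matrix.mulVec, dotProduct, hφ, mul_sub, Finset.sum_sub_distrib]
    rw [← Finset.sum_mul, h.pow_row_sum]
    simp
  rw [e]
  have πA0 : 0 ≤ ∑ z ∈ A, π z := Finset.sum_nonneg fun z _ => (h.pi_pos z).le
  have πA1 : ∑ z ∈ A, π z ≤ 1 := by
    rw [← h.pi_sum]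
    exact Finset.sum_le_sum_of_subset_of_nonneg (Finset.subset_univ A) fun z _ _ => (h.pi_pos z).le
  have φ1 : ∀ y, |φ y| ≤ 1 := fun y => by
    simp only [hφ]; rw [abs_le]; split_ifs <;> constructor <;> linarith
  have meanφ : ∑ y, π y * φ y = 0 := by
    simp only [hφ, mul_sub, Finset.sum_sub_distrib]
    rw [← Finset.sum_mul, h.pi_sum]
    simp
  have powφ : ∀ j y, |(P ^ j).mulVec φ y| ≤ 1 := by
    intro j y
    calc |(P ^ j).mulVec φ y| ≤ ∑ z, |(P ^ j) y z * φ z| := Finset.abs_sum_le_sum_abs _ _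
      _ ≤ ∑ z, (P ^ j) y z := Finset.sum_le_sum fun z _ => by
          rw [abs_mul, abs_of_nonneg (h.pow_nonneg _ _ _)]
          exact mul_le_of_le_one_right (h.pow_nonneg _ _ _) (φ1 z)
      _ = 1 := h.pow_row_sum _ _
  -- the chain started at `o`
  have ato : ∀ j, k ≤ j → |(P ^ j).mulVec φ o| ≤ 1 / 8 := by
    intro j hj
    set w : V → ℝ := fun x => (if x = o then 1 / π o else 0) - 1 with hw
    have h1 : (P ^ j).mulVec φ o = ∑ y, π y * (φ y * (P ^ j).mulVec w y) := by
      rw [← sum_pi_pow_mulVec_mul hr]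
      have hpo := (h.pi_pos o).ne'
      simp only [hw, mul_sub, Finset.sum_sub_distrib, mul_ite, mul_zero, mul_one]
      rw [Finset.sum_ite_eq' Finset.univ o, if_pos (Finset.mem_univ o), h.sum_pi_pow_mulVec, meanφ]
      field_simp
      simp
    have h2 := h.mul_sum_pi_sq_le hr hl hg hH j
    rw [← hw] at h2
    set Dj := ∑ x, π x * (P ^ j).mulVec w x ^ 2 with hDj
    have hj' : 64 * H ≤ j := hk1.trans (by exact_mod_cast hj)
    have hD0 : 0 ≤ Dj := Finset.sum_nonneg fun y _ => mul_nonneg (h.pi_pos y).le (sq_nonneg _)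
    have h3 : Dj ≤ 1 / 64 := by
      by_contra hc
      push Not at hc
      nlinarith
    have h4 : |(P ^ j).mulVec φ o| ≤ ∑ y, π y * (1 / 16 + 4 * (P ^ j).mulVec w y ^ 2) := by
      rw [h1]
      refine (Finset.abs_sum_le_sum_abs _ _).trans (Finset.sum_le_sum fun y _ => ?_)
      rw [abs_mul, abs_of_pos (h.pi_pos y), abs_mul]
      refine mul_le_mul_of_nonneg_left ?_ (h.pi_pos y).le
      have h5 : |φ y| * |(P ^ j).mulVec w y| ≤ |(P ^ j).mulVec w y| :=
        mul_le_of_le_one_left (abs_nonneg _) (φ1 y)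
      have h6 := sq_abs ((P ^ j).mulVec w y)
      nlinarith [sq_nonneg (|(P ^ j).mulVec w y| * 2 - 1 / 4)]
    have h5 : ∑ y, π y * (1 / 16 + 4 * (P ^ j).mulVec w y ^ 2) = 1 / 16 + 4 * Dj := by
      have : ∀ y, π y * (1 / 16 + 4 * (P ^ j).mulVec w y ^ 2) =
          π y * (1 / 16) + 4 * (π y * (P ^ j).mulVec w y ^ 2) := fun y => by ring
      simp only [this, Finset.sum_add_distrib]
      rw [← Finset.sum_mul, h.pi_sum, ← Finset.mul_sum, one_mul]
    rw [h5] at h4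
    linarith
  -- First-step induction in place of the strong Markov property at the hitting time of `o`: `ato`
  -- covers every time from `k` on, so at least `k` steps remain when `o` is hit.
  have claim : ∀ m y, |(P ^ (k + m)).mulVec φ y| ≤ 1 / 8 + q m y := by
    intro m
    induction m with
    | zero =>
      intro y
      by_cases hy : y = o
      · subst hy; rw [qo]; linarith [ato (k + 0) (by omega)]
      · rw [q0 y hy]; linarith [powφ (k + 0) y]
    | succ m ih =>
      intro y
      by_cases hy : y = o
      · subst hy; rw [qo]; linarith [ato (k + (m + 1)) (by omega)]
      · rw [q1 m y hy, ← add_assoc, mulVec_pow_succ]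
        calc |∑ z, P y z * (P ^ (k + m)).mulVec φ z|
            ≤ ∑ z, |P y z * (P ^ (k + m)).mulVec φ z| := Finset.abs_sum_le_sum_abs _ _
          _ ≤ ∑ z, P y z * (1 / 8 + q m z) := Finset.sum_le_sum fun z _ => by
              rw [abs_mul, abs_of_nonneg (h.nonneg _ _)]
              exact mul_le_mul_of_nonneg_left (ih z) (h.nonneg _ _)
          _ = _ := by
              simp only [mul_add, Finset.sum_add_distrib]
              rw [← Finset.sum_mul, h.row_sum, one_mul]
  have h1 := claim n x
  have h2 : q n x ≤ 1 / 8 := by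
    have := qg n x
    by_contra hc
    push Not at hc
    nlinarith [hH x]
  linarith

end Reversible

end IsUniformFlow

end Mixing

/-! ### Rooted trees, branches and coarse maps -/

section Geometry

/-- Every vertex of `G` has at most `Δ` neighbours. -/
def DegreeLE {V : Type u} (G : SimpleGraph V) (Δ : ℕ) : Prop :=
  ∀ (x : V) (s : Finset V), (∀ y ∈ s, G.Adj x y) → s.card ≤ Δ

lemma degreeLE_of_maxDeg_le {V : Type u} [Fintype V] {G : SimpleGraph V} {Δ : ℕ}
    (h : maxDeg G ≤ Δ) : DegreeLE G Δ := by
  classical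
  intro x s hs
  have h1 : s ⊆ G.neighborFinset x := fun y hy => by simpa using hs y hy
  refine (Finset.card_le_card h1).trans (le_trans ?_ h)
  rw [SimpleGraph.card_neighborFinset_eq_degree]
  unfold maxDeg
  convert G.degree_le_maxDegree x

lemma DegreeLE.card_ball_le {V : Type u} [Fintype V] {G : SimpleGraph V} {Δ : ℕ}
    (h : DegreeLE G Δ) (hG : G.Connected) (x : V) (k : ℕ) (s : Finset V)
    (hs : ∀ y ∈ s, G.dist x y ≤ k) : s.card ≤ (Δ + 1) ^ k := by
  classical
  induction k generalizing s with
  | zero =>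
    have : s ⊆ {x} := fun y hy => by
      have := (hG.dist_eq_zero_iff).1 (Nat.le_zero.1 (hs y hy))
      simp [this]
    simpa using Finset.card_le_card this
  | succ k ih =>
    set B := Finset.univ.filter fun y => G.dist x y ≤ k with hB
    have hBc := ih B fun y hy => (Finset.mem_filter.1 hy).2
    have hsub : s ⊆ B.biUnion fun z => insert z (G.neighborFinset z) := by
      intro y hy
      rw [Finset.mem_biUnion]
      obtain ⟨p, hp⟩ := hG.exists_walk_length_eq_dist y x
      cases p with
      | nil => exact ⟨x, by simp [hB], by simp⟩
      | @cons _ z _ hyz p =>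
        refine ⟨z, ?_, by simp [hyz.symm]⟩
        have h1 := SimpleGraph.dist_le p
        have h2 := hs y hy
        rw [SimpleGraph.dist_comm] at h1 h2
        rw [SimpleGraph.Walk.length_cons] at hp
        simp only [hB, Finset.mem_filter, Finset.mem_univ, true_and]
        omega
    calc s.card ≤ _ := Finset.card_le_card hsub
      _ ≤ B.card * (Δ + 1) := Finset.card_biUnion_le_card_mul _ _ _ fun z _ =>
          (Finset.card_insert_le _ _).trans
            (Nat.succ_le_succ (h z _ fun y hy => by simpa using hy))
      _ ≤ (Δ + 1) ^ (k + 1) := by rw [pow_succ]; exact Nat.mul_le_mul_right _ hBc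

/-- A connected finite graph has a vertex such that at most half of the vertices lie behind any
neighbour. -/
lemma exists_centroid {W : Type v} [Fintype W] {T : SimpleGraph W} (hT : T.Connected) :
    ∃ o, ∀ v, T.Adj o v → ∀ U : Finset W, (∀ w ∈ U, T.dist o w = T.dist v w + 1) →
      2 * U.card ≤ Fintype.card W := by
  classical
  have := hT.nonempty
  -- A minimiser of the total distance works: moving to `v` lowers the distance to each vertex of
  -- `U` by one and raises any other by at most one.
  obtain ⟨o, ho⟩ := Finite.exists_min fun o => ∑ w, T.dist o w
  refine ⟨o, fun v hv U hU => ?_⟩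
  have h1 : ∑ w, (T.dist v w + 2 * if w ∈ U then 1 else 0) ≤ ∑ w, (T.dist o w + 1) := by
    refine Finset.sum_le_sum fun w _ => ?_
    split_ifs with hw
    · rw [hU w hw]
    · have := hT.dist_triangle (u := v) (v := o) (w := w)
      rw [(SimpleGraph.dist_eq_one_iff_adj).2 hv.symm] at this
      omega
  rw [Finset.sum_add_distrib, Finset.sum_add_distrib, ← Finset.mul_sum] at h1
  simp at h1
  have := ho v
  omega

/-- `par` maps every vertex of the tree `T` to its neighbour in the direction of the root `o`. -/
structure IsRooting {W : Type v} (T : SimpleGraph W) (o : W) (par : W → W) : Prop where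
  connected : T.Connected
  root : par o = o
  adj_par : ∀ v, v ≠ o → T.Adj v (par v)
  dist_par : ∀ v, v ≠ o → T.dist o (par v) + 1 = T.dist o v
  par_of_adj : ∀ v w, T.Adj v w → par v = w ∨ par w = v

/-- The parent is the second vertex of a geodesic to `o`. It is unique because two candidates would
extend to two different paths from `o` to `v`. -/
lemma exists_rooting {W : Type v} {T : SimpleGraph W} (hT : T.IsTree) (o : W) :
    ∃ par, IsRooting T o par := by
  classical
  have hc := hT.connected
  have ex : ∀ v, v ≠ o → ∃ p, T.Adj v p ∧ T.dist o p + 1 = T.dist o v := by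
    intro v hv
    obtain ⟨p, hp⟩ := hc.exists_walk_length_eq_dist v o
    cases p with
    | nil => exact absurd rfl hv
    | @cons _ z _ hyz p =>
      refine ⟨z, hyz, ?_⟩
      have h1 := SimpleGraph.dist_le p
      rw [SimpleGraph.dist_comm] at h1 hp
      rw [SimpleGraph.Walk.length_cons] at hp
      rcases hT.dist_eq_dist_add_one_of_adj o hyz with h | h <;> omega
  have uniq : ∀ v p q, T.Adj v p → T.Adj v q → T.dist o p + 1 = T.dist o v →
      T.dist o q + 1 = T.dist o v → p = q := by
    intro v p q hp hq h1 h2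
    obtain ⟨a, ha⟩ := hc.exists_walk_length_eq_dist o p
    obtain ⟨b, hb⟩ := hc.exists_walk_length_eq_dist o q
    have pa : (a.concat hp.symm).IsPath :=
      SimpleGraph.Walk.isPath_of_length_eq_dist _ (by rw [SimpleGraph.Walk.length_concat]; omega)
    have pb : (b.concat hq.symm).IsPath :=
      SimpleGraph.Walk.isPath_of_length_eq_dist _ (by rw [SimpleGraph.Walk.length_concat]; omega)
    have := (hT.existsUnique_path o v).unique pa pb
    have := congrArg SimpleGraph.Walk.penultimate this
    simpa using this
  choose! par hpar using ex
  refine ⟨fun v => if v = o then o else par v, hc, by simp, fun v hv => ?_, fun v hv => ?_,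
    fun v w hvw => ?_⟩
  · simp only [if_neg hv]; exact (hpar v hv).1
  · simp only [if_neg hv]; exact (hpar v hv).2
  · rcases hT.dist_eq_dist_add_one_of_adj o hvw with h | h
    · left
      have hv : v ≠ o := by rintro rfl; simp at h
      simp only [if_neg hv]
      exact uniq v _ _ (hpar v hv).1 hvw (hpar v hv).2 h.symm
    · right
      have hw : w ≠ o := by rintro rfl; simp at h
      simp only [if_neg hw]
      exact uniq w _ _ (hpar w hw).1 hvw.symm (hpar w hw).2 h.symm

namespace IsRooting

variable {W : Type v} {T : SimpleGraph W} {o : W} {par : W → W}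

lemma dist_iterate (h : IsRooting T o par) (w : W) (k : ℕ) :
    T.dist o (par^[k] w) = T.dist o w - k := by
  induction k with
  | zero => simp
  | succ k ih =>
    rw [Function.iterate_succ_apply']
    by_cases hv : par^[k] w = o
    · rw [hv, h.root, SimpleGraph.dist_self]
      rw [hv, SimpleGraph.dist_self] at ih
      omega
    · have := h.dist_par _ hv
      omega

lemma iterate_eq_root (h : IsRooting T o par) {w : W} {k : ℕ} (hk : T.dist o w ≤ k) :
    par^[k] w = o := by
  have := h.dist_iterate w k
  rw [Nat.sub_eq_zero_of_le hk] at this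
  exact ((h.connected.dist_eq_zero_iff).1 this).symm

end IsRooting

section Desc

variable {W : Type v} [Fintype W] {T : SimpleGraph W} {o : W} {par : W → W}

open Classical in
/-- The set of descendants of `v`, including `v`. -/
def desc (par : W → W) (v : W) : Finset W := Finset.univ.filter fun w => ∃ k, par^[k] w = v

lemma mem_desc {v w : W} : w ∈ desc par v ↔ ∃ k, par^[k] w = v := by simp [desc]

lemma self_mem_desc (v : W) : v ∈ desc par v := mem_desc.2 ⟨0, rfl⟩

lemma mem_desc_iterate (w : W) (k : ℕ) : w ∈ desc par (par^[k] w) := mem_desc.2 ⟨k, rfl⟩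

lemma desc_subset_desc_par (v : W) : desc par v ⊆ desc par (par v) := fun w hw => by
  obtain ⟨k, rfl⟩ := mem_desc.1 hw
  exact mem_desc.2 ⟨k + 1, Function.iterate_succ_apply' _ _ _⟩

lemma desc_subset_desc_iterate (v : W) (k : ℕ) : desc par v ⊆ desc par (par^[k] v) := by
  induction k with
  | zero => exact fun _ h => h
  | succ k ih =>
    rw [Function.iterate_succ_apply']
    exact ih.trans (desc_subset_desc_par _)

lemma desc_iterate_mono (v : W) {j k : ℕ} (h : j ≤ k) :
    desc par (par^[j] v) ⊆ desc par (par^[k] v) := by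
  obtain ⟨i, rfl⟩ := Nat.exists_eq_add_of_le h
  rw [add_comm, Function.iterate_add_apply]
  exact desc_subset_desc_iterate _ _

namespace IsRooting

lemma root_notMem_desc (h : IsRooting T o par) {v : W} (hv : v ≠ o) : o ∉ desc par v := by
  intro ho
  obtain ⟨k, hk⟩ := mem_desc.1 ho
  rw [h.iterate_eq_root (by simp)] at hk
  exact hv hk.symm

lemma desc_root (h : IsRooting T o par) : desc par o = Finset.univ := by
  ext w
  simp only [Finset.mem_univ, iff_true]
  exact mem_desc.2 ⟨_, h.iterate_eq_root le_rfl⟩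

/-- The edge from `v` to its parent is the only way out of a branch; this bottleneck is where the
tree structure enters. -/
lemma mem_desc_of_adj (h : IsRooting T o par) {v x y : W} (hx : x ∈ desc par v)
    (hxy : T.Adj x y) : y ∈ desc par v ∨ x = v ∧ y = par v := by
  obtain ⟨k, hk⟩ := mem_desc.1 hx
  rcases h.par_of_adj x y hxy with e | e
  · cases k with
    | zero => exact Or.inr ⟨hk, by rw [← e]; exact congrArg par hk⟩
    | succ k =>
      left
      rw [Function.iterate_succ_apply, e] at hk
      exact mem_desc.2 ⟨k, hk⟩
  · left
    refine mem_desc.2 ⟨k + 1, ?_⟩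
    rw [Function.iterate_succ_apply, e, hk]

/-- A walk leaving the descendants of `v` passes through `v` and its parent. -/
lemma dist_add_le (h : IsRooting T o par) {v x y : W} (hx : x ∈ desc par v)
    (hy : y ∉ desc par v) : T.dist x v + 1 + T.dist (par v) y ≤ T.dist x y := by
  obtain ⟨p, hp⟩ := h.connected.exists_walk_length_eq_dist x y
  rw [← hp]
  clear hp
  induction p with
  | nil => exact absurd hx hy
  | @cons x z y hxz p ih =>
    rw [SimpleGraph.Walk.length_cons]
    rcases h.mem_desc_of_adj hx hxz with hz | ⟨rfl, rfl⟩
    · have h1 := ih hz hy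
      have h2 := h.connected.dist_triangle (u := x) (v := z) (w := v)
      rw [(SimpleGraph.dist_eq_one_iff_adj).2 hxz] at h2
      omega
    · have := SimpleGraph.dist_le p
      rw [SimpleGraph.dist_self]
      omega

/-- Each step of a walk leaves the current branch at most for the branch of the parent. -/
lemma mem_desc_iterate_of_dist_le (h : IsRooting T o par) {v x y : W} {k : ℕ}
    (hx : x ∈ desc par v) (hxy : T.dist x y ≤ k) : y ∈ desc par (par^[k] v) := by
  obtain ⟨p, hp⟩ := h.connected.exists_walk_length_eq_dist x y
  rw [← hp] at hxy
  refine desc_iterate_mono v hxy ?_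
  clear hp hxy
  induction p generalizing v with
  | nil => exact hx
  | @cons x z y hxz p ih =>
    rw [SimpleGraph.Walk.length_cons, Function.iterate_succ_apply]
    refine ih ?_
    rcases h.mem_desc_of_adj hx hxz with hz | ⟨-, rfl⟩
    · exact desc_subset_desc_par v hz
    · exact self_mem_desc _

/-- The total size of the branches containing `w`. -/
def _root_.MarkovRI.branchWeight (T : SimpleGraph W) (o : W) (par : W → W) (w : W) : ℕ :=
  ∑ i ∈ Finset.range (T.dist o w + 1), (desc par (par^[i] w)).card

lemma branchWeight_root (h : IsRooting T o par) :
    branchWeight T o par o = Fintype.card W := by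
  simp [branchWeight, h.desc_root]

lemma branchWeight_of_ne (h : IsRooting T o par) {v : W} (hv : v ≠ o) :
    branchWeight T o par v = branchWeight T o par (par v) + (desc par v).card := by
  rw [branchWeight, Finset.sum_range_succ', branchWeight, h.dist_par v hv]
  simp only [Function.iterate_succ_apply, Function.iterate_zero, id]

end IsRooting

end Desc

/-- A map from the vertices of `G` to those of `T` that distorts distances by a bounded amount and
has coarsely dense range. -/
structure IsCoarse {V : Type u} {W : Type v} (G : SimpleGraph V) (T : SimpleGraph W) (φ : V → W)
    (ρ : ℕ) : Prop where
  lip : ∀ x y, G.Adj x y → T.dist (φ x) (φ y) ≤ ρ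
  colip : ∀ x y, G.dist x y ≤ ρ * (T.dist (φ x) (φ y) + 1)
  dense : ∀ w, ∃ x, T.dist (φ x) w ≤ ρ

namespace IsCoarse

variable {V : Type u} {W : Type v} {G : SimpleGraph V}
  {T : SimpleGraph W} {φ : V → W} {ρ Δ : ℕ}

/-- By `colip`, each fibre of `φ` lies in a ball of radius `ρ`. -/
lemma card_le_of_maps [Fintype V] (h : IsCoarse G T φ ρ) (hG : G.Connected) (hΔ : DegreeLE G Δ)
    {A : Finset V} {U : Finset W} (hA : ∀ x ∈ A, φ x ∈ U) :
    A.card ≤ (Δ + 1) ^ ρ * U.card := by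
  classical
  refine Finset.card_le_mul_card_image_of_maps_to hA _ fun w _ => ?_
  rcases (A.filter fun x => φ x = w).eq_empty_or_nonempty with he | ⟨x, hx⟩
  · rw [he]; simp
  · refine hΔ.card_ball_le hG x ρ _ fun y hy => ?_
    have := h.colip x y
    rw [(Finset.mem_filter.1 hx).2, (Finset.mem_filter.1 hy).2, SimpleGraph.dist_self] at this
    simpa using this

/-- Send each `w` to a vertex whose image is within `ρ` of it; the fibres lie in balls of radius `ρ`
in `T`. -/
lemma card_le_of_dense [Fintype W] (h : IsCoarse G T φ ρ) (hT : T.Connected) (hΔ : DegreeLE T Δ)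
    {A : Finset V} {U : Finset W} (hA : ∀ w ∈ U, ∀ x, T.dist (φ x) w ≤ ρ → x ∈ A) :
    U.card ≤ (Δ + 1) ^ ρ * A.card := by
  classical
  choose ψ hψ using h.dense
  refine Finset.card_le_mul_card_image_of_maps_to (f := ψ) (fun w hw => hA w hw _ (hψ w)) _
    fun x _ => ?_
  refine hΔ.card_ball_le hT (φ x) ρ _ fun w hw => ?_
  rw [← (Finset.mem_filter.1 hw).2]
  exact hψ w

end IsCoarse

end Geometry

/-! ### Increments of Dirichlet solutions along branches -/

section Comparison

/-- Bounds the distance in `G` of two vertices whose images are at distance at most `2ρ + 1`. -/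
def hopBound (ρ : ℕ) : ℕ := ρ * (2 * ρ + 2)

/-- The number of generations over which a lower bound is propagated. -/
def stride (ρ : ℕ) : ℕ := ρ * (hopBound ρ + 1) + 1

variable {V : Type u} [Fintype V] {W : Type v} [Fintype W] {G : SimpleGraph V}
  {P : Matrix V V ℝ} {π : V → ℝ} {K : ℝ} {Δ ρ : ℕ} {T : SimpleGraph W} {o : W} {par : W → W}
  {φ : V → W}

lemma IsCoarse.dist_le_hopBound {V : Type u} {W : Type v} {G : SimpleGraph V}
    {T : SimpleGraph W} {φ : V → W} {ρ : ℕ} (h : IsCoarse G T φ ρ) {x y : V}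
    (hxy : T.dist (φ x) (φ y) ≤ 2 * ρ + 1) : G.dist x y ≤ hopBound ρ :=
  (h.colip x y).trans (Nat.mul_le_mul_left _ (by omega))

lemma IsCoarse.dist_le_walk {V : Type u} {W : Type v} {G : SimpleGraph V}
    {T : SimpleGraph W} {φ : V → W} {ρ : ℕ} (h : IsCoarse G T φ ρ) (hT : T.Connected) {x y : V}
    (p : G.Walk x y) : T.dist (φ x) (φ y) ≤ ρ * p.length := by
  induction p with
  | nil => simp
  | @cons x y z hxy p ih =>
    rw [SimpleGraph.Walk.length_cons, mul_add, mul_one]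
    have := hT.dist_triangle (u := φ x) (v := φ y) (w := φ z)
    have := h.lip x y hxy
    omega

/-- Upper bound for hitting times of a vertex near the root. -/
lemma IsHittingTime.le_branchWeight {x₀ : V} {g : V → ℝ} (hg : IsHittingTime P x₀ g) (h : IsUniformFlow G P π K)
    (hΔ : DegreeLE G Δ) (hr : IsRooting T o par) (hc : IsCoarse G T φ ρ)
    (hx₀ : T.dist (φ x₀) o ≤ ρ) (x : V) :
    g x ≤ hopBound ρ * (K * (Δ + 1) ^ ρ) * branchWeight T o par (φ x) := by
  classical
  set C : ℝ := hopBound ρ * (K * (Δ + 1) ^ ρ) with hC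
  have hK := h.const_pos
  -- a bounded walk to a place where `g ≤ a` raises the bound by a multiple of the branch size
  have key : ∀ (A : Finset V) (U : Finset W) (a : ℝ) (x z : V), x₀ ∉ A → (∀ x ∈ A, φ x ∈ U) →
      (∀ x ∈ A, ∀ y ∉ A, G.Adj x y → g y ≤ a) → x ∈ A → g z ≤ a →
      T.dist (φ x) (φ z) ≤ 2 * ρ + 1 → g x ≤ a + C * U.card := by
    intro A U a x z hA hAU hbd hx hz hd
    obtain ⟨p, hp⟩ := h.connected.exists_walk_length_eq_dist x z
    have h1 := h.le_add_length_mul (fun y hy => hg.eqn y fun e => hA (e ▸ hy)) hbd p hz hx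
    have h2 : (p.length : ℝ) ≤ hopBound ρ := by
      rw [hp]; exact_mod_cast hc.dist_le_hopBound hd
    have h3 : (A.card : ℝ) ≤ (Δ + 1) ^ ρ * U.card := by
      exact_mod_cast hc.card_le_of_maps h.connected hΔ hAU
    have h4 : (p.length : ℝ) * (K * A.card) ≤ hopBound ρ * (K * ((Δ + 1) ^ ρ * U.card)) := by
      gcongr
    have h5 : C * U.card = hopBound ρ * (K * ((Δ + 1) ^ ρ * U.card)) := by rw [hC]; ring
    linarith
  -- Induction on depth, for all vertices over a ball around `v` rather than over `v` itself,
  -- because `φ` need not be onto.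
  have main : ∀ n v, T.dist o v = n → ∀ x, T.dist (φ x) v ≤ ρ → g x ≤ C * branchWeight T o par v := by
    intro n
    induction n with
    | zero =>
      intro v hv x hx
      obtain rfl := (hr.connected.dist_eq_zero_iff).1 hv
      rw [hr.branchWeight_root, ← Finset.card_univ]
      by_cases hxx : x = x₀
      · subst hxx
        rw [hg.root, hC]; positivity
      · have := key (Finset.univ.erase x₀) Finset.univ 0 x x₀ (by simp) (by simp)
          (fun a _ b hb _ => by
            have : b = x₀ := by simpa using hb
            rw [this, hg.root]) (by simp [hxx]) hg.root.le (by
            have := hr.connected.dist_triangle (u := φ x) (v := o) (w := φ x₀)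
            rw [SimpleGraph.dist_comm (u := o)] at this
            omega)
        linarith
    | succ n ih =>
      intro v hv x hx
      have hvo : v ≠ o := by rintro rfl; simp at hv
      have hdp := hr.dist_par v hvo
      have ihp := ih (par v) (by omega)
      set a := C * branchWeight T o par (par v) with ha
      have hadj : T.dist v (par v) = 1 := (SimpleGraph.dist_eq_one_iff_adj).2 (hr.adj_par v hvo)
      rw [hr.branchWeight_of_ne hvo]
      push_cast
      rw [mul_add, ← ha]
      by_cases hxp : T.dist (φ x) (par v) ≤ ρ
      · have : 0 ≤ C * (desc par v).card := by rw [hC]; positivity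
        linarith [ihp x hxp]
      -- An edge of `G` leaving the branch of `v` lands within `ρ` of `par v`, since its image
      -- crosses the bottleneck. So every exit from `A` reaches a vertex where the induction
      -- hypothesis gives `g ≤ a`.
      set A := Finset.univ.filter fun y => φ y ∈ desc par v ∧ ¬ T.dist (φ y) (par v) ≤ ρ with hA
      have memA : ∀ y, y ∈ A ↔ φ y ∈ desc par v ∧ ¬ T.dist (φ y) (par v) ≤ ρ := by simp [hA]
      obtain ⟨z, hz⟩ := hc.dense (par v)
      refine key A (desc par v) a x z ?_ (fun y hy => ((memA y).1 hy).1) ?_ ?_ (ihp z hz) ?_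
      · rw [memA]
        rintro ⟨h1, h2⟩
        have h3 := hr.dist_add_le h1 (hr.root_notMem_desc hvo)
        have h4 := hr.connected.dist_triangle (u := φ x₀) (v := v) (w := par v)
        omega
      · intro y hy y' hy' hyy
        refine ihp y' ?_
        by_cases hd : φ y' ∈ desc par v
        · by_contra hcon
          exact hy' ((memA y').2 ⟨hd, hcon⟩)
        · have h3 := hr.dist_add_le ((memA y).1 hy).1 hd
          have h4 := hc.lip y y' hyy
          rw [SimpleGraph.dist_comm]
          omega
      · rw [memA]
        refine ⟨?_, hxp⟩
        by_contra hd
        have h3 := hr.dist_add_le (self_mem_desc v) hd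
        rw [SimpleGraph.dist_comm (u := v) (v := φ x), SimpleGraph.dist_comm (u := par v)] at h3
        omega
      · have h4 := hr.connected.dist_triangle (u := φ x) (v := v) (w := φ z)
        have h5 := hr.connected.dist_triangle (u := v) (v := par v) (w := φ z)
        rw [SimpleGraph.dist_comm (u := par v) (v := φ z)] at h5
        omega
  exact main _ _ rfl x (by simp)

/-- Elementary Harnack inequality across an edge. -/
lemma IsUniformFlow.sub_le_mul_sub (h : IsUniformFlow G P π K) {g : V → ℝ} {b : ℝ} {z z' : V}
    (hz : g z = 1 + ∑ y, P z y * g y) (hb : b ≤ g z) (hb' : ∀ y, G.Adj z y → b ≤ g y)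
    (hzz : G.Adj z z') : g z' - b ≤ K * (g z - b) := by
  classical
  have h1 := h.sum_mul_le_of_nbr z (f := fun y => b + if y = z' then g z' - b else 0) (f' := g)
    (by simp [hzz.ne, hb]) (fun y hy => by
      by_cases e : y = z'
      · subst e; simp
      · simp [e, hb' y hy])
  simp only [mul_add, Finset.sum_add_distrib, mul_ite, mul_zero] at h1
  rw [← Finset.sum_mul, h.row_sum, Finset.sum_ite_eq' Finset.univ z', if_pos (Finset.mem_univ _)]
    at h1
  have h2 : P z z' * (g z' - b) ≤ g z - b := by linarith
  have h3 := mul_le_mul_of_nonneg_left h2 h.const_pos.le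
  have h4 := mul_le_mul_of_nonneg_right (h.one_le_mul hzz) (sub_nonneg.2 (hb' z' hzz))
  linarith

lemma IsUniformFlow.one_le_const (h : IsUniformFlow G P π K) : 1 ≤ K := by
  obtain ⟨x⟩ := h.connected.nonempty
  obtain ⟨y, hy⟩ := h.exists_adj x
  have h1 := h.one_le_mul hy
  have := mul_le_mul_of_nonneg_left (h.le_one x y) h.const_pos.le
  linarith

/-- Some boundary vertex of a bottleneck set `A` has a large value. -/
lemma IsUniformFlow.exists_boundary (h : IsUniformFlow G P π K) [DecidableEq V] {A : Finset V}
    {g : V → ℝ} {b : ℝ} {N : ℕ} (hA : A.Nonempty)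
    (hg : ∀ x ∈ A, g x = 1 + ∑ y, P x y * g y)
    (hbd : ∀ x ∈ A, ∀ y ∉ A, G.Adj x y → b ≤ g y) (hgb : ∀ x ∈ A, b ≤ g x)
    (hN : ∀ s : Finset (V × V), (∀ p ∈ s, p.1 ∈ A ∧ p.2 ∉ A ∧ G.Adj p.1 p.2) → s.card ≤ N) :
    ∃ x ∈ A, ∃ y ∉ A, G.Adj x y ∧ A.card ≤ N * K * (g x - b) := by
  classical
  have := h.nontrivial
  -- With the least mass `π m` as unit, `π(A)` is at least the size of `A`, and each boundary edge
  -- carries at most `K * (g x - b)`; the unit cancels at the end.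
  obtain ⟨m, hm⟩ := Finite.exists_min π
  set B := (A ×ˢ Aᶜ).filter fun p => G.Adj p.1 p.2 with hB
  have memB : ∀ p, p ∈ B ↔ p.1 ∈ A ∧ p.2 ∉ A ∧ G.Adj p.1 p.2 := fun p => by
    simp [hB, and_assoc]
  have id := h.cut_identity A g b
  have r : ∑ z ∈ A, π z * (g z - ∑ y, P z y * g y) = ∑ z ∈ A, π z :=
    Finset.sum_congr rfl fun z hz => by rw [hg z hz]; ring
  rw [r, ← Finset.sum_product' A Aᶜ
    (fun x y => π y * P y x * (g x - b) + π x * P x y * (b - g y))] at id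
  have low : A.card * π m ≤ ∑ z ∈ A, π z := by
    rw [← nsmul_eq_mul]
    exact Finset.card_nsmul_le_sum _ _ _ fun z _ => hm z
  have up : ∑ p ∈ A ×ˢ Aᶜ, (π p.2 * P p.2 p.1 * (g p.1 - b) + π p.1 * P p.1 p.2 * (b - g p.2)) ≤
      ∑ p ∈ B, K * π m * (g p.1 - b) := by
    rw [hB, Finset.sum_filter]
    refine Finset.sum_le_sum fun p hp => ?_
    rw [Finset.mem_product, Finset.mem_compl] at hp
    have hne : p.1 ≠ p.2 := fun e => hp.2 (e ▸ hp.1)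
    split_ifs with ha
    · have h1 : π p.1 * P p.1 p.2 * (b - g p.2) ≤ 0 :=
        mul_nonpos_of_nonneg_of_nonpos (mul_nonneg (h.pi_pos _).le (h.nonneg _ _))
          (sub_nonpos.2 (hbd _ hp.1 _ hp.2 ha))
      have h2 : π p.2 * P p.2 p.1 * (g p.1 - b) ≤ K * π m * (g p.1 - b) := by
        refine mul_le_mul_of_nonneg_right ?_ (sub_nonneg.2 (hgb _ hp.1))
        exact (mul_le_of_le_one_right (h.pi_pos _).le (h.le_one _ _)).trans (h.pi_le _ _)
      linarith
    · rw [h.support _ _ hne ha, h.support _ _ hne.symm fun e => ha e.symm]; simp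
  rw [id] at up
  have hcard : (0 : ℝ) < A.card := by exact_mod_cast hA.card_pos
  have hpm := h.pi_pos m
  have Bne : B.Nonempty := by
    rw [Finset.nonempty_iff_ne_empty]
    intro e
    rw [e, Finset.sum_empty] at up
    have := mul_pos hcard hpm
    linarith
  obtain ⟨p, hp, hmax⟩ := Finset.exists_max_image B (fun p => g p.1) Bne
  obtain ⟨hp1, hp2, hp3⟩ := (memB p).1 hp
  refine ⟨p.1, hp1, p.2, hp2, hp3, ?_⟩
  have hgp : 0 ≤ g p.1 - b := sub_nonneg.2 (hgb _ hp1)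
  have hK := h.const_pos
  have up2 : ∑ q ∈ B, K * π m * (g q.1 - b) ≤ B.card * (K * π m * (g p.1 - b)) := by
    rw [← nsmul_eq_mul]
    exact Finset.sum_le_card_nsmul _ _ _ fun q hq =>
      mul_le_mul_of_nonneg_left (by linarith [hmax q hq]) (by positivity)
  have hBN : (B.card : ℝ) ≤ N := by exact_mod_cast hN B fun q hq => (memB q).1 hq
  have up3 : (B.card : ℝ) * (K * π m * (g p.1 - b)) ≤ N * (K * π m * (g p.1 - b)) :=
    mul_le_mul_of_nonneg_right hBN (by positivity)
  have fin : π m * A.card ≤ π m * (N * K * (g p.1 - b)) := by linarith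
  exact le_of_mul_le_mul_left fin hpm

/-- A lower bound on an ancestral branch improves on the branch of `v` by an amount proportional to
its size. -/
lemma IsUniformFlow.lower_step (h : IsUniformFlow G P π K) (hΔ : DegreeLE G Δ)
    (hr : IsRooting T o par) (hc : IsCoarse G T φ ρ) [DecidableEq V] {S : Finset V}
    (hS : ∃ z, z ∉ S) {g : V → ℝ}
    (hg : ∀ x ∈ S, g x = 1 + ∑ y, P x y * g y) {v : W} {b : ℝ}
    (hE : ∀ x, φ x ∈ desc par (par^[stride ρ] v) → x ∈ S ∧ b ≤ g x)
    {A : Finset V} (hA : ∀ x, x ∈ A ↔ φ x ∈ desc par v) :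
    ∀ x ∈ A, b + A.card / (((Δ + 1) ^ hopBound ρ) ^ 2 * K ^ (hopBound ρ + 1)) ≤ g x := by
  classical
  intro x hx
  have hK1 := h.one_le_const
  have hK := h.const_pos
  -- vertices whose image is at most `stride` generations above `v`
  have near : ∀ k, k ≤ stride ρ → ∀ x, φ x ∈ desc par (par^[k] v) → x ∈ S ∧ b ≤ g x :=
    fun k hk x hx => hE x (desc_iterate_mono v hk hx)
  have hAS : ∀ x ∈ A, x ∈ S ∧ b ≤ g x := fun x hx => near 0 (Nat.zero_le _) x ((hA x).1 hx)
  have hρ : ρ ≤ stride ρ := by unfold stride; nlinarith [Nat.zero_le (hopBound ρ)]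
  have hbd : ∀ x ∈ A, ∀ y ∉ A, G.Adj x y → b ≤ g y := fun x hx y _ hxy =>
    (near ρ hρ y (hr.mem_desc_iterate_of_dist_le ((hA x).1 hx) (hc.lip x y hxy))).2
  have hvo : v ≠ o := by
    rintro rfl
    obtain ⟨z, hz⟩ := hS
    exact hz (hAS z ((hA z).2 (by rw [hr.desc_root]; exact Finset.mem_univ _))).1
  have hadj : T.dist v (par v) = 1 := (SimpleGraph.dist_eq_one_iff_adj).2 (hr.adj_par v hvo)
  have bdist : ∀ x ∈ A, ∀ y ∉ A, G.Adj x y →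
      T.dist (φ x) v + 1 + T.dist (par v) (φ y) ≤ ρ := fun x hx y hy hxy =>
    (hr.dist_add_le ((hA x).1 hx) fun e => hy ((hA y).2 e)).trans (hc.lip x y hxy)
  -- any two boundary vertices are close
  have close : ∀ x ∈ A, ∀ y ∉ A, G.Adj x y → ∀ x' ∈ A, ∀ y' ∉ A, G.Adj x' y' →
      G.dist x x' ≤ hopBound ρ ∧ G.dist x y' ≤ hopBound ρ := by
    intro x hx y hy hxy x' hx' y' hy' hxy'
    have h1 := bdist x hx y hy hxy
    have h2 := bdist x' hx' y' hy' hxy'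
    have h3 := hr.connected.dist_triangle (u := φ x) (v := v) (w := φ x')
    have h4 := hr.connected.dist_triangle (u := φ x) (v := v) (w := φ y')
    have h5 := hr.connected.dist_triangle (u := v) (v := par v) (w := φ y')
    rw [SimpleGraph.dist_comm (u := v) (v := φ x')] at h3
    exact ⟨hc.dist_le_hopBound (by omega), hc.dist_le_hopBound (by omega)⟩
  have count : ∀ s : Finset (V × V), (∀ p ∈ s, p.1 ∈ A ∧ p.2 ∉ A ∧ G.Adj p.1 p.2) →
      s.card ≤ ((Δ + 1) ^ hopBound ρ) ^ 2 := by
    intro s hs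
    rcases s.eq_empty_or_nonempty with rfl | ⟨p, hp⟩
    · simp
    obtain ⟨hp1, hp2, hp3⟩ := hs p hp
    set B := Finset.univ.filter fun y => G.dist p.1 y ≤ hopBound ρ with hB
    have hBc : B.card ≤ (Δ + 1) ^ hopBound ρ :=
      hΔ.card_ball_le h.connected p.1 _ B fun y hy => (Finset.mem_filter.1 hy).2
    have hsub : s ⊆ B ×ˢ B := fun q hq => by
      obtain ⟨hq1, hq2, hq3⟩ := hs q hq
      have := close _ hp1 _ hp2 hp3 _ hq1 _ hq2 hq3
      simp [hB, this.1, this.2]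
    calc s.card ≤ (B ×ˢ B).card := Finset.card_le_card hsub
      _ = B.card ^ 2 := by rw [Finset.card_product, sq]
      _ ≤ _ := Nat.pow_le_pow_left hBc 2
  -- One boundary vertex carries a gain proportional to the size of `A`. Harnack spreads the gain to
  -- the whole outer boundary, within distance `hopBound ρ` of it, and the minimum principle carries
  -- it into `A`.
  obtain ⟨x₁, hx₁, y₁, hy₁, hxy₁, hbig⟩ := h.exists_boundary ⟨x, hx⟩
    (fun x hx => hg x (hAS x hx).1) hbd (fun x hx => (hAS x hx).2) count
  -- Harnack along a bounded walk
  have harnack : ∀ z (p : G.Walk z x₁), p.length ≤ hopBound ρ →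
      g x₁ - b ≤ K ^ p.length * (g z - b) := by
    intro z p
    induction p with
    | nil => intro _; simp
    | @cons z z' x₁ hzz p ih =>
      intro hl
      have e : (SimpleGraph.Walk.cons hzz p).length = p.length + 1 :=
        SimpleGraph.Walk.length_cons _ _
      have ih' := ih hx₁ hxy₁ hbig (by omega)
      have hd := hc.dist_le_walk hr.connected (SimpleGraph.Walk.cons hzz p)
      rw [SimpleGraph.dist_comm] at hd
      have hmem := hr.mem_desc_iterate_of_dist_le ((hA _).1 hx₁) hd
      -- A walk of length at most `hopBound ρ` climbs at most `ρ * hopBound ρ` generations, and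
      -- looking at a neighbour costs `ρ` more. This dictates `stride`.
      have hle : ρ * (SimpleGraph.Walk.cons hzz p).length + ρ ≤ stride ρ := by
        unfold stride
        have := Nat.mul_le_mul_left ρ hl
        rw [mul_add]; omega
      have hz := near _ ((Nat.le_add_right _ _).trans hle) z hmem
      have hb' : ∀ y, G.Adj z y → b ≤ g y := fun y hy => by
        have := hr.mem_desc_iterate_of_dist_le hmem (hc.lip z y hy)
        rw [← Function.iterate_add_apply, add_comm] at this
        exact (near _ hle y this).2
      have h1 := h.sub_le_mul_sub (hg z hz.1) hz.2 hb' hzz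
      rw [e, pow_succ, mul_assoc]
      exact ih'.trans (mul_le_mul_of_nonneg_left h1 (by positivity))
  refine h.le_of_superharmonic (fun x hx => hg x (hAS x hx).1) (fun x hx y hy hxy => ?_) x hx
  obtain ⟨p, hp⟩ := h.connected.exists_walk_length_eq_dist y x₁
  have hpl : p.length ≤ hopBound ρ := by
    rw [hp, SimpleGraph.dist_comm]
    exact (close _ hx₁ _ hy₁ hxy₁ _ hx _ hy hxy).2
  have h1 := harnack y p hpl
  have h2 : K ^ p.length * (g y - b) ≤ K ^ hopBound ρ * (g y - b) :=
    mul_le_mul_of_nonneg_right (pow_le_pow_right₀ hK1 hpl) (sub_nonneg.2 (hbd x hx y hy hxy))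
  have h3 : (A.card : ℝ) ≤ ((Δ + 1) ^ hopBound ρ) ^ 2 * K * (K ^ hopBound ρ * (g y - b)) := by
    push_cast at hbig
    exact hbig.trans (mul_le_mul_of_nonneg_left (h1.trans h2) (by positivity))
  have h4 : A.card / (((Δ + 1 : ℝ) ^ hopBound ρ) ^ 2 * K ^ (hopBound ρ + 1)) ≤ g y - b := by
    rw [div_le_iff₀ (by positivity), pow_succ K]
    linarith
  linarith

end Comparison

/-! ### Escape bounds from branch weights -/

section LowerBound

variable {V : Type u} [Fintype V] {W : Type v} [Fintype W] {G : SimpleGraph V}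
  {P : Matrix V V ℝ} {π : V → ℝ} {K : ℝ} {Δ ρ : ℕ} {T : SimpleGraph W} {o : W} {par : W → W}
  {φ : V → W}

/-- The gain of one step of the lower bound, relative to the size of the branch. -/
def stepConst (Δ ρ : ℕ) (K : ℝ) : ℝ :=
  1 / (((Δ + 1) ^ hopBound ρ) ^ 2 * K ^ (hopBound ρ + 1) * (Δ + 1) ^ ρ)

lemma stepConst_pos {Δ ρ : ℕ} {K : ℝ} (hK : 0 < K) : 0 < stepConst Δ ρ K := by
  unfold stepConst; positivity

/-- `lower_step` is applied `ρ` generations above `u`: the preimage of the branch of `u` may be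
empty, but every vertex mapped within `ρ` of that branch lies over the branch of `par^[ρ] u`. -/
lemma IsUniformFlow.lower_generation (h : IsUniformFlow G P π K) (hΔ : DegreeLE G Δ)
    (hΔT : DegreeLE T Δ) (hr : IsRooting T o par) (hc : IsCoarse G T φ ρ) {S : Finset V}
    (hS : ∃ z, z ∉ S) {g : V → ℝ} (hg : ∀ x ∈ S, g x = 1 + ∑ y, P x y * g y) {u : W} {b : ℝ}
    (hE : ∀ x, φ x ∈ desc par (par^[stride ρ + ρ] u) → x ∈ S ∧ b ≤ g x) (x : V)
    (hx : φ x ∈ desc par (par^[ρ] u)) : b + stepConst Δ ρ K * (desc par u).card ≤ g x := by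
  classical
  have hK := h.const_pos
  set A := Finset.univ.filter fun x => φ x ∈ desc par (par^[ρ] u) with hA
  have memA : ∀ x, x ∈ A ↔ φ x ∈ desc par (par^[ρ] u) := by simp [hA]
  have h1 := h.lower_step hΔ hr hc hS hg (v := par^[ρ] u) (b := b)
    (by simpa only [Function.iterate_add_apply] using hE) memA x ((memA x).2 hx)
  have h2 : (desc par u).card ≤ (Δ + 1) ^ ρ * A.card :=
    hc.card_le_of_dense hr.connected hΔT fun w hw x hxw => (memA x).2
      (hr.mem_desc_iterate_of_dist_le hw (by rwa [SimpleGraph.dist_comm]))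
  have h3 : ((desc par u).card : ℝ) ≤ (Δ + 1) ^ ρ * A.card := by exact_mod_cast h2
  have h4 : stepConst Δ ρ K * (desc par u).card ≤
      A.card / (((Δ + 1) ^ hopBound ρ) ^ 2 * K ^ (hopBound ρ + 1)) := by
    refine (mul_le_mul_of_nonneg_left h3 (stepConst_pos hK).le).trans (le_of_eq ?_)
    unfold stepConst
    field_simp
  linarith

/-- Each descent by `stride ρ` generations gains a multiple of the branch at its upper end, which
dominates the `stride ρ` smaller branches below; hence the division by `stride ρ`. The number `d` is
only fuel for the descending induction on `i`. -/
lemma IsUniformFlow.lower_telescope (h : IsUniformFlow G P π K) (hΔ : DegreeLE G Δ)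
    (hΔT : DegreeLE T Δ) (hr : IsRooting T o par) (hc : IsCoarse G T φ ρ) {S : Finset V}
    (hS : ∃ z, z ∉ S) {g : V → ℝ} (hg0 : ∀ x, 0 ≤ g x)
    (hg : ∀ x ∈ S, g x = 1 + ∑ y, P x y * g y) {w : W} {N top : ℕ}
    (htop : N + 2 * stride ρ + ρ ≤ top + 1) (hdom : ∀ x, φ x ∈ desc par (par^[top] w) → x ∈ S)
    (d i : ℕ) (hd : N ≤ i + d) (x : V) (hx : φ x ∈ desc par (par^[i + stride ρ + ρ] w)) :
    stepConst Δ ρ K / stride ρ * ∑ k ∈ Finset.Ico i N, ((desc par (par^[k] w)).card : ℝ) ≤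
      g x := by
  have hK := h.const_pos
  have hE : 0 < stride ρ := Nat.succ_pos _
  induction d generalizing i x with
  | zero => rw [Finset.Ico_eq_empty (by omega)]; simpa using hg0 x
  | succ d ih =>
    by_cases hi : N ≤ i
    · rw [Finset.Ico_eq_empty (by omega)]; simpa using hg0 x
    push Not at hi
    set s := stride ρ with hs
    have h1 := h.lower_generation hΔ hΔT hr hc hS hg (u := par^[i + s] w)
      (b := stepConst Δ ρ K / s * ∑ k ∈ Finset.Ico (i + s) N, ((desc par (par^[k] w)).card : ℝ))
      (fun y hy => by
        rw [← Function.iterate_add_apply] at hy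
        refine ⟨hdom y (desc_iterate_mono w (by omega) hy), ih (i + s) (by omega) y ?_⟩
        rwa [show i + s + s + ρ = stride ρ + ρ + (i + s) by omega]) x (by rwa [← Function.iterate_add_apply, add_comm])
    have h2 : ∑ k ∈ Finset.Ico i N, ((desc par (par^[k] w)).card : ℝ) ≤
        ∑ k ∈ Finset.Ico i (i + s), ((desc par (par^[k] w)).card : ℝ) +
        ∑ k ∈ Finset.Ico (i + s) N, ((desc par (par^[k] w)).card : ℝ) := by
      classical
      rw [← Finset.sum_union (Finset.Ico_disjoint_Ico_consecutive _ _ _)]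
      refine Finset.sum_le_sum_of_subset_of_nonneg (fun k hk => ?_) fun _ _ _ => Nat.cast_nonneg _
      simp only [Finset.mem_union, Finset.mem_Ico] at hk ⊢
      omega
    have h3 : ∑ k ∈ Finset.Ico i (i + s), ((desc par (par^[k] w)).card : ℝ) ≤
        s * (desc par (par^[i + s] w)).card := by
      have := Finset.sum_le_card_nsmul (Finset.Ico i (i + s))
        (fun k => ((desc par (par^[k] w)).card : ℝ)) ((desc par (par^[i + s] w)).card : ℝ)
        fun k hk => by
          rw [Finset.mem_Ico] at hk
          exact_mod_cast Finset.card_le_card (desc_iterate_mono w hk.2.le)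
      simpa using this
    have hs0 : (0 : ℝ) < s := by exact_mod_cast hE
    have hsc := stepConst_pos (Δ := Δ) (ρ := ρ) hK
    have h4 : stepConst Δ ρ K / s * (s * (desc par (par^[i + s] w)).card) =
        stepConst Δ ρ K * (desc par (par^[i + s] w)).card := by field_simp
    have h5 := mul_le_mul_of_nonneg_left (h2.trans (add_le_add_left h3 _))
      (div_pos hsc hs0).le
    rw [mul_add, h4] at h5
    linarith

/-- A test function supported on a set whose complement has mass at least `c` that reaches `m`. -/
def EscapeBound (P : Matrix V V ℝ) (π : V → ℝ) (c m : ℝ) : Prop :=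
  ∃ (S : Finset V) (g : V → ℝ) (x : V), (∀ x, 0 ≤ g x) ∧ (∀ x ∉ S, g x = 0) ∧
    (∀ x, g x ≤ 1 + ∑ y, P x y * g y) ∧ ∑ x ∈ S, π x ≤ 1 - c ∧ m ≤ g x

lemma EscapeBound.mono {c c' m m' : ℝ} (h : EscapeBound P π c m) (hc : c' ≤ c) (hm : m' ≤ m) :
    EscapeBound P π c' m' := by
  obtain ⟨S, g, x, h1, h2, h3, h4, h5⟩ := h
  exact ⟨S, g, x, h1, h2, h3, h4.trans (by linarith), hm.trans h5⟩

/-- At a maximiser `s`, the mean of `g` is at most `(1 - c) * g s`, so duality yields `c * g s`. -/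
lemma EscapeBound.le_tStop [DecidableEq V] {c m : ℝ} (he : EscapeBound P π c m)
    (h : IsUniformFlow G P π K) (hc : 0 ≤ c) : ENNReal.ofReal (c * m) ≤ tStop P π := by
  obtain ⟨S, g, x, h1, h2, h3, h4, h5⟩ := he
  have := h.nontrivial
  obtain ⟨s, hs⟩ := Finite.exists_max g
  refine le_trans (ENNReal.ofReal_le_ofReal ?_) (h.le_tStop h3 s)
  have h6 : ∑ x, π x * g x ≤ (1 - c) * g s := by
    calc ∑ x, π x * g x = ∑ x ∈ S, π x * g x := by
          refine (Finset.sum_subset (Finset.subset_univ S) fun y _ hy => ?_).symm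
          rw [h2 y hy, mul_zero]
      _ ≤ ∑ x ∈ S, π x * g s :=
          Finset.sum_le_sum fun y _ => mul_le_mul_of_nonneg_left (hs y) (h.pi_pos y).le
      _ = (∑ x ∈ S, π x) * g s := by rw [Finset.sum_mul]
      _ ≤ _ := mul_le_mul_of_nonneg_right h4 (h1 s)
  nlinarith [mul_le_mul_of_nonneg_left (h5.trans (hs x)) hc]

lemma EscapeBound.le_tMix [DecidableEq V] {c m : ℝ} (he : EscapeBound P π c m)
    (h : IsUniformFlow G P π K) (hc : 0 ≤ c) {k : ℕ} (hk0 : 0 < k)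
    (hk : 2 * (1 / 2 : ℝ) ^ k ≤ c / 2) : ENNReal.ofReal (c / (2 * k) * m) ≤ tMix P π := by
  obtain ⟨S, g, x, h1, h2, h3, h4, h5⟩ := he
  refine le_trans (ENNReal.ofReal_le_ofReal ?_) (h.le_tMix h1 h2 h3 h4 hk0 hk x)
  exact mul_le_mul_of_nonneg_left h5 (by positivity)

/-- A single vertex of mass at most `1/2` suffices when the tree is too small for the branch
estimates. -/
lemma IsUniformFlow.escapeBound_singleton (h : IsUniformFlow G P π K) :
    EscapeBound P π (1 / 2) 1 := by
  classical
  have := h.nontrivial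
  obtain ⟨a, b, hab⟩ := exists_pair_ne V
  have h1 : π a + π b ≤ 1 := by
    rw [← h.pi_sum, ← Finset.sum_pair hab]
    exact Finset.sum_le_sum_of_subset_of_nonneg (Finset.subset_univ _) fun z _ _ =>
      (h.pi_pos z).le
  obtain ⟨s, hs⟩ : ∃ s, π s ≤ 1 - 1 / 2 := by
    by_contra hcon
    push Not at hcon
    linarith [hcon a, hcon b]
  refine ⟨{s}, fun x => if x = s then 1 else 0, s, fun x => ?_, fun x hx => ?_, fun x => ?_, ?_, ?_⟩
  · dsimp only; split_ifs <;> norm_num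
  · simpa using hx
  · have : 0 ≤ ∑ y, P x y * (if y = s then 1 else 0) := Finset.sum_nonneg fun y _ =>
      mul_nonneg (h.nonneg _ _) (by split_ifs <;> norm_num)
    dsimp only; split_ifs <;> linarith
  · simpa using hs
  · simp

/-- The number of generations lost in the lower bound. -/
def lostGenerations (ρ : ℕ) : ℕ := 2 * stride ρ + 2 * ρ

/-- A lower bound for the mass outside a branch. -/
def massConst (Δ ρ : ℕ) (K : ℝ) : ℝ := 1 / (2 * K * (Δ + 1) ^ (2 * ρ))

lemma massConst_pos {Δ ρ : ℕ} {K : ℝ} (hK : 0 < K) : 0 < massConst Δ ρ K := by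
  unfold massConst; positivity

/-- Rooted at a centroid, every branch yields an escape bound. -/
lemma IsUniformFlow.escapeBound_branch (h : IsUniformFlow G P π K) (hΔ : DegreeLE G Δ)
    (hΔT : DegreeLE T Δ) (hr : IsRooting T o par) (hc : IsCoarse G T φ ρ)
    (ho : ∀ v, T.Adj o v → 2 * (desc par v).card ≤ Fintype.card W) (w : W) {N : ℕ}
    (hN : N + lostGenerations ρ ≤ T.dist o w) :
    EscapeBound P π (massConst Δ ρ K) (stepConst Δ ρ K / stride ρ *
      ∑ k ∈ Finset.range N, ((desc par (par^[k] w)).card : ℝ)) := by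
  classical
  have hK := h.const_pos
  unfold lostGenerations at hN
  have hE : 0 < stride ρ := Nat.succ_pos _
  set t := T.dist o w with ht
  -- `S` lies over a branch starting `ρ` generations below a child `c` of the root. Vertices mapped
  -- within `ρ` of a point outside the branch of `c` thus avoid `S`, and by the centroid property
  -- those points are at least half of `T`.
  set top := t - (1 + ρ) with htop
  set S := Finset.univ.filter fun x => φ x ∈ desc par (par^[top] w) with hS
  have memS : ∀ x, x ∈ S ↔ φ x ∈ desc par (par^[top] w) := by simp [hS]
  -- the child of the root above `w`
  set c := par^[t - 1] w with hcdef
  have hcd : T.dist o c = 1 := by rw [hcdef, hr.dist_iterate]; omega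
  have hcw : 2 * (desc par c).card ≤ Fintype.card W :=
    ho c ((SimpleGraph.dist_eq_one_iff_adj).1 hcd)
  have hcount : (Finset.univ \ desc par c).card ≤ (Δ + 1) ^ ρ * (Finset.univ \ S).card := by
    refine hc.card_le_of_dense hr.connected hΔT fun w' hw' x hx => ?_
    simp only [Finset.mem_sdiff, Finset.mem_univ, true_and] at hw' ⊢
    intro hxS
    have := hr.mem_desc_iterate_of_dist_le ((memS x).1 hxS) hx
    rw [← Function.iterate_add_apply, show ρ + top = t - 1 by omega] at this
    exact hw' this
  have hVW : (Finset.univ : Finset V).card ≤ (Δ + 1) ^ ρ * (Finset.univ : Finset W).card :=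
    hc.card_le_of_maps h.connected hΔ fun x _ => Finset.mem_univ _
  rw [Finset.card_sdiff_of_subset (Finset.subset_univ _), Finset.card_univ] at hcount
  rw [Finset.card_univ, Finset.card_univ] at hVW
  have hW : 0 < Fintype.card W := Fintype.card_pos_iff.2 ⟨o⟩
  have hcount' : (Fintype.card W : ℝ) ≤ 2 * ((Δ + 1) ^ ρ * (Finset.univ \ S).card) := by
    have : Fintype.card W ≤ 2 * ((Δ + 1) ^ ρ * (Finset.univ \ S).card) := by omega
    exact_mod_cast this
  have hVW' : (Fintype.card V : ℝ) ≤ (Δ + 1) ^ ρ * Fintype.card W := by exact_mod_cast hVW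
  have hSne : ∃ z, z ∉ S := by
    by_contra hcon
    push Not at hcon
    have : Finset.univ \ S = ∅ := Finset.sdiff_eq_empty_iff_subset.2 fun x _ => hcon x
    rw [this] at hcount'
    have : (0 : ℝ) < Fintype.card W := by exact_mod_cast hW
    simp at hcount'
    omega
  have hmass : ∑ x ∈ S, π x ≤ 1 - massConst Δ ρ K := by
    have h1 := Finset.sum_sdiff (f := π) (Finset.subset_univ S)
    rw [h.pi_sum] at h1
    have h2 : ((Finset.univ \ S).card : ℝ) ≤ K * Fintype.card V * ∑ x ∈ Finset.univ \ S, π x := by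
      rw [Finset.mul_sum]
      have := Finset.card_nsmul_le_sum (Finset.univ \ S) (fun x => K * Fintype.card V * π x) 1
        fun x _ => h.one_le_card_mul x
      simpa using this
    -- The `2` comes from the centroid, one factor `(Δ + 1) ^ ρ` from each of the two cardinality
    -- comparisons, and `K` from the near-uniformity of `π`.
    have h3 : massConst Δ ρ K ≤ ∑ x ∈ Finset.univ \ S, π x := by
      set q := ∑ x ∈ Finset.univ \ S, π x
      have hq : 0 ≤ q := Finset.sum_nonneg fun x _ => (h.pi_pos x).le
      have hWR : (0 : ℝ) < Fintype.card W := by exact_mod_cast hW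
      have h4 : (Fintype.card W : ℝ) ≤
          Fintype.card W * (q * (2 * K * (Δ + 1) ^ (2 * ρ))) := by
        calc (Fintype.card W : ℝ) ≤ 2 * ((Δ + 1) ^ ρ * (Finset.univ \ S).card) := hcount'
          _ ≤ 2 * ((Δ + 1) ^ ρ * (K * Fintype.card V * q)) := by gcongr
          _ ≤ 2 * ((Δ + 1) ^ ρ * (K * ((Δ + 1) ^ ρ * Fintype.card W) * q)) := by gcongr
          _ = _ := by rw [mul_comm 2 ρ, pow_mul]; ring
      unfold massConst
      rw [div_le_iff₀ (by positivity)]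
      exact le_of_mul_le_mul_left (by linarith) hWR
    linarith
  obtain ⟨g, hg0, hg⟩ := h.exists_dirichlet hSne fun _ => 1
  have hgn := h.nonneg_of_dirichlet hSne (fun _ => zero_le_one) hg0 hg
  obtain ⟨x, hx⟩ := hc.dense w
  refine ⟨S, g, x, hgn, hg0, fun y => ?_, hmass, ?_⟩
  · by_cases hy : y ∈ S
    · exact (hg y hy).le
    · rw [hg0 y hy]
      have : 0 ≤ ∑ z, P y z * g z := Finset.sum_nonneg fun z _ => mul_nonneg (h.nonneg _ _) (hgn z)
      linarith
  · have := h.lower_telescope hΔ hΔT hr hc hSne hgn hg (w := w) (N := N) (top := top) (by omega)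
      (fun y hy => (memS y).2 hy) N 0 (by omega) x
      (desc_iterate_mono w (by omega) (hr.mem_desc_iterate_of_dist_le (self_mem_desc w)
        (by rwa [SimpleGraph.dist_comm] : T.dist w (φ x) ≤ ρ)))
    rwa [← Finset.range_eq_Ico] at this

/-- In a large tree some vertex of prescribed depth has a large branch. -/
lemma IsRooting.exists_large_branch (hr : IsRooting T o par) (hΔT : DegreeLE T Δ) {D : ℕ}
    (hW : 2 * (Δ + 1) ^ D < Fintype.card W) :
    ∃ w, T.dist o w = D ∧ Fintype.card W ≤ 2 * (Δ + 1) ^ D * (desc par w).card := by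
  classical
  set Z := Finset.univ.filter fun w => T.dist o w = D with hZ
  have memZ : ∀ w, w ∈ Z ↔ T.dist o w = D := by simp [hZ]
  set B := Finset.univ.filter fun w => T.dist o w ≤ D with hB
  have hZc : Z.card ≤ (Δ + 1) ^ D :=
    hΔT.card_ball_le hr.connected o D Z fun y hy => ((memZ y).1 hy).le
  have hBc : B.card ≤ (Δ + 1) ^ D :=
    hΔT.card_ball_le hr.connected o D B fun y hy => (Finset.mem_filter.1 hy).2
  have hcov : (Finset.univ : Finset W) ⊆ B ∪ Z.biUnion (desc par) := by
    intro w _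
    rw [Finset.mem_union, Finset.mem_biUnion]
    by_cases hw : T.dist o w ≤ D
    · left; simp [hB, hw]
    · right
      refine ⟨par^[T.dist o w - D] w, ?_, mem_desc_iterate _ _⟩
      rw [memZ, hr.dist_iterate]; omega
  have h1 := (Finset.card_le_card hcov).trans
    ((Finset.card_union_le _ _).trans (Nat.add_le_add_left Finset.card_biUnion_le _))
  rw [Finset.card_univ] at h1
  by_contra hcon
  push Not at hcon
  have h2 : ∑ z ∈ Z, 2 * (Δ + 1) ^ D * (desc par z).card ≤ Z.card * Fintype.card W := by
    rw [← smul_eq_mul]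
    exact Finset.sum_le_card_nsmul _ _ _ fun z hz => (hcon z ((memZ z).1 hz)).le
  rw [← Finset.mul_sum] at h2
  have h3 : Z.card * Fintype.card W ≤ (Δ + 1) ^ D * Fintype.card W := Nat.mul_le_mul_right _ hZc
  have hp : 0 < (Δ + 1) ^ D := by positivity
  have h4 : 2 * ∑ z ∈ Z, (desc par z).card ≤ Fintype.card W := by
    refine Nat.le_of_mul_le_mul_left (c := (Δ + 1) ^ D) ?_ hp
    calc _ = 2 * (Δ + 1) ^ D * ∑ z ∈ Z, (desc par z).card := by ring
      _ ≤ _ := h2.trans h3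
  omega

/-- The escape bounds are comparable to the branch weights. -/
lemma exists_escapeBound_const (Δ ρ : ℕ) {K : ℝ} (hK : 0 < K) :
    ∃ c : ℝ, 0 < c ∧ ∀ {V : Type u} [Fintype V] {W : Type v} [Fintype W] {G : SimpleGraph V}
      {P : Matrix V V ℝ} {π : V → ℝ} {T : SimpleGraph W} {o : W} {par : W → W} {φ : V → W},
      IsUniformFlow G P π K → DegreeLE G Δ → DegreeLE T Δ → IsRooting T o par →
      IsCoarse G T φ ρ → (∀ v, T.Adj o v → 2 * (desc par v).card ≤ Fintype.card W) →
      ∀ w, EscapeBound P π c (c * branchWeight T o par w) := by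
  set D := lostGenerations ρ with hD
  set s := stepConst Δ ρ K / stride ρ with hs
  have hs0 : 0 < s := div_pos (stepConst_pos hK) (by exact_mod_cast Nat.succ_pos _)
  set Cb : ℝ := 2 * (Δ + 1) ^ (D + 1) with hCb
  have hCb0 : 0 < Cb := by positivity
  -- a bound in terms of the number of vertices
  set a := min (1 / Cb) (s / Cb) with ha
  have ha0 : 0 < a := lt_min (by positivity) (by positivity)
  set m := min (1 / 2) (massConst Δ ρ K) with hm
  have hm0 : 0 < m := lt_min (by norm_num) (massConst_pos hK)
  set e := min (s / 2) (a / (2 * (D + 1))) with he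
  have he0 : 0 < e := lt_min (by positivity) (by positivity)
  refine ⟨min m e, lt_min hm0 he0, ?_⟩
  intro V _ W _ G P π T o par φ h hΔ hΔT hr hc ho w
  have hF0 : (0 : ℝ) ≤ branchWeight T o par w := Nat.cast_nonneg _
  have hn0 : (0 : ℝ) < Fintype.card W := by
    exact_mod_cast Fintype.card_pos_iff.2 ⟨o⟩
  -- A small tree uses a singleton; a large one uses a big branch at depth `D + 1`, just deep enough
  -- to keep one generation.
  have card : EscapeBound P π m (a * Fintype.card W) := by
    by_cases hW : Fintype.card W ≤ 2 * (Δ + 1) ^ (D + 1)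
    · refine h.escapeBound_singleton.mono (min_le_left _ _) ?_
      have hW' : (Fintype.card W : ℝ) ≤ Cb := by rw [hCb]; exact_mod_cast hW
      calc a * Fintype.card W ≤ 1 / Cb * Cb :=
            mul_le_mul (min_le_left _ _) hW' hn0.le (by positivity)
        _ = 1 := by field_simp
    · push Not at hW
      obtain ⟨w', hw', hbig⟩ := hr.exists_large_branch hΔT hW
      refine (h.escapeBound_branch hΔ hΔT hr hc ho w' (N := 1) (by omega)).mono
        (min_le_right _ _) ?_
      rw [Finset.sum_range_one, Function.iterate_zero, id]
      have hbig' : (Fintype.card W : ℝ) ≤ Cb * (desc par w').card := by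
        rw [hCb]; exact_mod_cast hbig
      calc a * Fintype.card W ≤ s / Cb * (Cb * (desc par w').card) :=
            mul_le_mul (min_le_right _ _) hbig' hn0.le (by positivity)
        _ = s * (desc par w').card := by field_simp
  have hle : min m e ≤ e := min_le_right _ _
  -- The branch bound misses the last `D + 1` terms of the weight, each at most the size of `T`.
  -- Either they may account for half of the weight and `card` suffices, or the remaining terms make
  -- up at least half.
  by_cases hF : (branchWeight T o par w : ℝ) ≤ 2 * (D + 1) * Fintype.card W
  · refine card.mono (min_le_left _ _) ?_
    calc min m e * branchWeight T o par w
        ≤ a / (2 * (D + 1)) * (2 * (D + 1) * Fintype.card W) :=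
          mul_le_mul (hle.trans (min_le_right _ _)) hF hF0 (by positivity)
      _ = a * Fintype.card W := by field_simp
  · push Not at hF
    have term : ∀ k, ((desc par (par^[k] w)).card : ℝ) ≤ Fintype.card W := fun k => by
      exact_mod_cast Finset.card_le_univ _
    have hsplit : ∀ N, N ≤ T.dist o w + 1 → (branchWeight T o par w : ℝ) ≤
        ∑ k ∈ Finset.range N, ((desc par (par^[k] w)).card : ℝ) +
          ((T.dist o w + 1 - N : ℕ) : ℝ) * Fintype.card W := by
      intro N hN
      rw [branchWeight, ← Finset.sum_range_add_sum_Ico _ hN]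
      push_cast
      have := Finset.sum_le_card_nsmul (Finset.Ico N (T.dist o w + 1))
        (fun k => ((desc par (par^[k] w)).card : ℝ)) _ fun k _ => term k
      rw [Nat.card_Ico, nsmul_eq_mul] at this
      linarith
    have hdepth : D ≤ T.dist o w := by
      by_contra hcon
      push Not at hcon
      have h1 := hsplit 0 (Nat.zero_le _)
      have h2 : ((T.dist o w + 1 - 0 : ℕ) : ℝ) ≤ D + 1 := by
        have : T.dist o w + 1 - 0 ≤ D + 1 := by omega
        exact_mod_cast this
      have h3 := mul_le_mul_of_nonneg_right h2 hn0.le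
      simp only [Finset.range_zero, Finset.sum_empty, zero_add] at h1
      nlinarith
    refine (h.escapeBound_branch hΔ hΔT hr hc ho w (N := T.dist o w - D) (by omega)).mono
      ((min_le_left _ _).trans (min_le_right _ _)) ?_
    have h1 := hsplit (T.dist o w - D) (by omega)
    rw [show T.dist o w + 1 - (T.dist o w - D) = D + 1 by omega] at h1
    push_cast at h1
    have h2 : (branchWeight T o par w : ℝ) ≤
        2 * ∑ k ∈ Finset.range (T.dist o w - D), ((desc par (par^[k] w)).card : ℝ) := by
      linarith
    calc min m e * branchWeight T o par w ≤ s / 2 *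
          (2 * ∑ k ∈ Finset.range (T.dist o w - D), ((desc par (par^[k] w)).card : ℝ)) :=
          mul_le_mul (hle.trans (min_le_left _ _)) h2 hF0 (by positivity)
      _ = _ := by ring

end LowerBound

/-! ### From lazy uniform chains to uniform flows -/

section Chain

lemma chainGraph_adj {V : Type u} {P : Matrix V V ℝ} {x y : V} :
    (chainGraph P).Adj x y ↔ x ≠ y ∧ (0 < P x y ∨ 0 < P y x) :=
  Iff.rfl

variable {V : Type u} [Fintype V] [DecidableEq V] {P : Matrix V V ℝ} {π : V → ℝ}

lemma IsLazyIrreducibleChain.nontrivial (h : IsLazyIrreducibleChain P π) : Nontrivial V := by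
  have hne : Nonempty V := by
    by_contra hcon
    rw [not_nonempty_iff] at hcon
    have := h.stationary.sum_eq_one
    simp at this
  by_contra hcon
  rw [not_nontrivial_iff_subsingleton] at hcon
  obtain ⟨x⟩ := hne
  have h1 := Matrix.sum_row_of_mem_rowStochastic h.stochastic x
  have h2 : ∑ y, P x y = P x x := Fintype.sum_eq_single x fun y hy => absurd (Subsingleton.elim _ _) hy
  rw [h2, h.lazy] at h1
  norm_num at h1

lemma IsLazyIrreducibleChain.pi_pos (h : IsLazyIrreducibleChain P π) (y : V) : 0 < π y := by
  obtain ⟨a, ha⟩ : ∃ a, 0 < π a := by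
    by_contra hcon
    push Not at hcon
    have := h.stationary.sum_eq_one
    linarith [Finset.sum_nonpos fun x (_ : x ∈ Finset.univ) => hcon x]
  obtain ⟨k, -, hk⟩ := (Matrix.isIrreducible_iff_exists_pow_pos (A := P)
    fun i j => Matrix.nonneg_of_mem_rowStochastic h.stochastic).1 h.irreducible a y
  rw [← sum_mul_pow_of_stationary h.stationary.stationary k y]
  have hnon : ∀ x ∈ Finset.univ, 0 ≤ π x * (P ^ k) x y := fun x _ =>
    mul_nonneg (h.stationary.nonneg x)
      (Matrix.nonneg_of_mem_rowStochastic (pow_mem h.stochastic k))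
  exact (mul_pos ha hk).trans_le (Finset.single_le_sum hnon (Finset.mem_univ a))

lemma IsLazyIrreducibleChain.connected (h : IsLazyIrreducibleChain P π) :
    (chainGraph P).Connected := by
  have := h.nontrivial
  refine ⟨fun a b => ?_⟩
  obtain ⟨k, -, hk⟩ := (Matrix.isIrreducible_iff_exists_pow_pos (A := P)
    fun i j => Matrix.nonneg_of_mem_rowStochastic h.stochastic).1 h.irreducible a b
  induction k generalizing b with
  | zero =>
    rw [pow_zero, Matrix.one_apply] at hk
    split_ifs at hk with e
    · rw [e]
    · exact absurd hk (lt_irrefl _)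
  | succ k ih =>
    rw [pow_succ, Matrix.mul_apply] at hk
    obtain ⟨z, -, hz⟩ := Finset.exists_ne_zero_of_sum_ne_zero hk.ne'
    have h1 := Matrix.nonneg_of_mem_rowStochastic (pow_mem h.stochastic k) (i := a) (j := z)
    have h2 := Matrix.nonneg_of_mem_rowStochastic h.stochastic (i := z) (j := b)
    have hz1 : 0 < (P ^ k) a z := lt_of_le_of_ne h1 (Ne.symm (left_ne_zero_of_mul hz))
    have hz2 : 0 < P z b := lt_of_le_of_ne h2 (Ne.symm (right_ne_zero_of_mul hz))
    refine (ih z hz1).trans ?_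
    by_cases e : z = b
    · rw [e]
    · exact (chainGraph_adj.2 ⟨e, Or.inl hz2⟩ : (chainGraph P).Adj z b).reachable

/-- By laziness `π z` is twice the flow out of `z`, which uses at most `Δ` edges, each carrying at
most `1 / ε` times the flow of any given edge. Using `Δ + 1` keeps the constant positive. -/
lemma IsLazyIrreducibleChain.isUniformFlow (h : IsLazyIrreducibleChain P π) {ε : ℝ} (hε : 0 < ε)
    (hU : IsUniform ε P π) {Δ : ℕ} (hΔ : DegreeLE (chainGraph P) Δ) :
    IsUniformFlow (chainGraph P) P π (2 * (Δ + 1) / ε) where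
  nonneg _ _ := Matrix.nonneg_of_mem_rowStochastic h.stochastic
  row_sum := Matrix.sum_row_of_mem_rowStochastic h.stochastic
  pi_pos := h.pi_pos
  pi_sum := h.stationary.sum_eq_one
  stationary := h.stationary.stationary
  support x y hxy hn := by
    have h1 := Matrix.nonneg_of_mem_rowStochastic h.stochastic (i := x) (j := y)
    by_contra hcon
    exact hn (chainGraph_adj.2 ⟨hxy, Or.inl (lt_of_le_of_ne h1 (Ne.symm hcon))⟩)
  const_pos := by positivity
  le_flow x y z hxy := by
    classical
    have hnn : ∀ a b, 0 ≤ P a b := fun _ _ => Matrix.nonneg_of_mem_rowStochastic h.stochastic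
    set f := π x * P x y with hf
    have hf0 : 0 ≤ f := mul_nonneg (h.pi_pos x).le (hnn x y)
    have hrow := Matrix.sum_row_of_mem_rowStochastic h.stochastic z
    rw [← Finset.add_sum_erase _ _ (Finset.mem_univ z), h.lazy] at hrow
    have h1 : π z = 2 * ∑ b ∈ Finset.univ.erase z, π z * P z b := by
      rw [← Finset.mul_sum]
      have : ∑ b ∈ Finset.univ.erase z, P z b = 1 / 2 := by linarith
      rw [this]; ring
    have h2 : ∑ b ∈ Finset.univ.erase z, π z * P z b ≤
        ∑ b ∈ Finset.univ.filter (fun b => (chainGraph P).Adj z b), f / ε := by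
      rw [Finset.sum_filter]
      refine (Finset.sum_le_sum fun b hb => ?_).trans
        (Finset.sum_le_sum_of_subset_of_nonneg (Finset.erase_subset z _) fun b _ _ => ?_)
      · split_ifs with ha
        · exact (hU x y z b hxy ha).2
        · have : P z b = 0 := by
            by_contra hcon
            exact ha (chainGraph_adj.2 ⟨(Finset.ne_of_mem_erase hb).symm,
              Or.inl (lt_of_le_of_ne (hnn z b) (Ne.symm hcon))⟩)
          rw [this, mul_zero]
      · split_ifs
        · positivity
        · exact le_rfl
    rw [Finset.sum_const, nsmul_eq_mul] at h2
    have h3 : ((Finset.univ.filter fun b => (chainGraph P).Adj z b).card : ℝ) ≤ Δ + 1 := by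
      have := hΔ z (Finset.univ.filter fun b => (chainGraph P).Adj z b)
        fun b hb => (Finset.mem_filter.1 hb).2
      exact_mod_cast this.trans (Nat.le_succ _)
    have h4 := mul_le_mul_of_nonneg_right h3 (div_nonneg hf0 hε.le)
    have h5 : 2 * (Δ + 1) / ε * f = 2 * ((Δ + 1) * (f / ε)) := by ring
    rw [h1, h5]
    linarith
  connected := h.connected
  nontrivial := h.nontrivial

end Chain

/-! ### Coarse maps from rough isometries, and conclusion -/

lemma RoughlyIsometric.exists_isCoarse {V : Type u} {W : Type v} {G : SimpleGraph V}
    {T : SimpleGraph W} {r : ℝ} (h : RoughlyIsometric r G T) :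
    ∃ φ : V → W, IsCoarse G T φ ⌈2 * |r|⌉₊ := by
  obtain ⟨R, ⟨hV, hW⟩, hr⟩ := h
  have key : ∀ x y x' y', R x x' → R y y' →
      max (T.dist x' y' : ℝ) (G.dist x y) + 1 ≤
        |r| * (min (T.dist x' y' : ℝ) (G.dist x y) + 1) := by
    intro x y x' y' hx hy
    have h1 := hr ⟨x, y, x', y', hx, hy, rfl⟩
    have h2 : (0 : ℝ) < min (T.dist x' y' : ℝ) (G.dist x y) + 1 := by positivity
    rw [div_le_iff₀ h2] at h1
    exact h1.trans (mul_le_mul_of_nonneg_right (le_abs_self r) h2.le)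
  choose φ hφ using hV
  -- The `2` accounts for the `+ 1` in the stretch of an edge, whose smaller distance plus one is at
  -- most `2`.
  have hceil := Nat.le_ceil (2 * |r|)
  have hr0 := abs_nonneg r
  refine ⟨φ, fun x y hxy => ?_, fun x y => ?_, fun w => ?_⟩
  · have h1 := key x y _ _ (hφ x) (hφ y)
    rw [(SimpleGraph.dist_eq_one_iff_adj).2 hxy] at h1
    have h2 := mul_le_mul_of_nonneg_left
      (add_le_add_left (min_le_right (T.dist (φ x) (φ y) : ℝ) ((1 : ℕ) : ℝ)) 1) hr0
    have h3 := le_max_left (T.dist (φ x) (φ y) : ℝ) ((1 : ℕ) : ℝ)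
    have : (T.dist (φ x) (φ y) : ℝ) ≤ ⌈2 * |r|⌉₊ := by push_cast at h1 h2 h3; linarith
    exact_mod_cast this
  · have h1 := key x y _ _ (hφ x) (hφ y)
    have h2 := mul_le_mul_of_nonneg_left
      (add_le_add_left (min_le_left (T.dist (φ x) (φ y) : ℝ) (G.dist x y)) 1) hr0
    have h3 := le_max_right (T.dist (φ x) (φ y) : ℝ) (G.dist x y)
    have h4 : |r| * (T.dist (φ x) (φ y) + 1 : ℝ) ≤ ⌈2 * |r|⌉₊ * (T.dist (φ x) (φ y) + 1) :=
      mul_le_mul_of_nonneg_right (by linarith) (by positivity)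
    have : (G.dist x y : ℝ) ≤ ⌈2 * |r|⌉₊ * (T.dist (φ x) (φ y) + 1) := by linarith
    exact_mod_cast this
  · obtain ⟨x, hx⟩ := hW w
    refine ⟨x, ?_⟩
    have h1 := key x x _ _ (hφ x) hx
    rw [SimpleGraph.dist_self] at h1
    have h2 := mul_le_mul_of_nonneg_left
      (add_le_add_left (min_le_right (T.dist (φ x) w : ℝ) ((0 : ℕ) : ℝ)) 1) hr0
    have h3 := le_max_left (T.dist (φ x) w : ℝ) ((0 : ℕ) : ℝ)
    have : (T.dist (φ x) w : ℝ) ≤ ⌈2 * |r|⌉₊ := by push_cast at h1 h2 h3; linarith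
    exact_mod_cast this

lemma IsCoarse.mono {V : Type u} {W : Type v} {G : SimpleGraph V} {T : SimpleGraph W} {φ : V → W}
    {ρ ρ' : ℕ} (h : IsCoarse G T φ ρ) (hρ : ρ ≤ ρ') : IsCoarse G T φ ρ' :=
  ⟨fun x y hxy => (h.lip x y hxy).trans hρ,
    fun x y => (h.colip x y).trans (Nat.mul_le_mul_right _ hρ),
    fun w => (h.dense w).imp fun _ hx => hx.trans hρ⟩

lemma isCoarse_id {W : Type v} (T : SimpleGraph W) : IsCoarse T T id 1 :=
  ⟨fun _ _ h => ((SimpleGraph.dist_eq_one_iff_adj).2 h).le, fun x y => by simp,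
    fun w => ⟨w, by simp⟩⟩

/-- Stopping and mixing times of chains on graphs that coarsely look like a tree are comparable to
the maximal branch weight of the tree. -/
lemma exists_branchWeight_bounds (Δ ρ : ℕ) {K : ℝ} (hK : 0 < K) :
    ∃ C : ℝ, 0 < C ∧ ∀ {V : Type u} [Fintype V] [DecidableEq V] {W : Type v} [Fintype W]
      {G : SimpleGraph V} {P : Matrix V V ℝ} {π : V → ℝ} {T : SimpleGraph W} {o : W}
      {par : W → W} {φ : V → W},
      IsUniformFlow G P π K → DegreeLE G Δ → DegreeLE T Δ → IsRooting T o par →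
      IsCoarse G T φ ρ → (∀ v, T.Adj o v → 2 * (desc par v).card ≤ Fintype.card W) →
      ∀ m, (∀ w, branchWeight T o par w ≤ branchWeight T o par m) →
        tStop P π ≤ ENNReal.ofReal (C * branchWeight T o par m) ∧
        ENNReal.ofReal (branchWeight T o par m / C) ≤ tStop P π ∧
        ENNReal.ofReal (branchWeight T o par m / C) ≤ tMix P π ∧
        (IsReversible P π → (∀ x, P x x = 1 / 2) →
          tMix P π ≤ ENNReal.ofReal (C * branchWeight T o par m)) := by
  obtain ⟨c, hc0, hesc⟩ := exists_escapeBound_const Δ ρ hK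
  obtain ⟨k, hk⟩ := exists_pow_lt_of_lt_one (show (0 : ℝ) < c / 4 by positivity)
    (show (1 / 2 : ℝ) < 1 by norm_num)
  have hk' : 2 * (1 / 2 : ℝ) ^ (k + 1) ≤ c / 2 := by
    rw [pow_succ]; nlinarith [show (0 : ℝ) < (1 / 2) ^ k by positivity]
  set C₁ : ℝ := hopBound ρ * (K * (Δ + 1) ^ ρ) with hC₁
  have hC₁0 : 0 ≤ C₁ := by positivity
  -- The summands serve the upper bounds, the lower bound for the stopping time and the lower bound
  -- for the mixing time.
  set C : ℝ := 74 * C₁ + 1 / (c * c) + 1 / (c / (2 * (k + 1 : ℕ)) * c) with hC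
  have hp1 : 0 < 1 / (c * c) := by positivity
  have hp2 : 0 < 1 / (c / (2 * (k + 1 : ℕ)) * c) := by positivity
  have hC0 : 0 < C := by positivity
  refine ⟨C, hC0, ?_⟩
  intro V _ _ W _ G P π T o par φ h hΔ hΔT hr hco ho m hm
  set M : ℝ := ((branchWeight T o par m : ℕ) : ℝ) with hM
  have hM0 : 0 ≤ M := Nat.cast_nonneg _
  obtain ⟨x₀, hx₀⟩ := hco.dense o
  have up : ∀ {Q : Matrix V V ℝ} {g : V → ℝ}, IsUniformFlow G Q π K → IsHittingTime Q x₀ g →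
      ∀ x, g x ≤ C₁ * M := by
    intro Q g hQ hg x
    refine (hg.le_branchWeight hQ hΔ hr hco hx₀ x).trans (mul_le_mul_of_nonneg_left ?_ hC₁0)
    exact Nat.cast_le.2 (hm (φ x))
  have he := hesc h hΔ hΔT hr hco ho m
  obtain ⟨g, hg⟩ := h.exists_hittingTime x₀
  obtain ⟨g', hg'⟩ := h.reversed.exists_hittingTime x₀
  have hCM : 74 * (C₁ * M) ≤ C * M := by
    rw [hC]; nlinarith [mul_nonneg hp1.le hM0, mul_nonneg hp2.le hM0]
  have low : ∀ a : ℝ, 0 < a → 1 / a ≤ C → M / C ≤ a * M := by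
    intro a ha haC
    rw [div_le_iff₀ hC0]
    rw [div_le_iff₀ ha] at haC
    nlinarith
  refine ⟨?_, ?_, ?_, fun hrev hl => ?_⟩
  · refine (h.tStop_le hg hg' (up h hg) (up h.reversed hg')).trans (ENNReal.ofReal_le_ofReal ?_)
    have := mul_nonneg hC₁0 hM0
    linarith
  · refine (ENNReal.ofReal_le_ofReal ?_).trans (he.le_tStop h hc0.le)
    rw [← mul_assoc]
    refine low _ (by positivity) ?_
    rw [hC]; linarith
  · refine (ENNReal.ofReal_le_ofReal ?_).trans (he.le_tMix h hc0.le (Nat.succ_pos k) hk')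
    rw [← mul_assoc]
    refine low _ (by positivity) ?_
    rw [hC]; linarith
  · exact (h.tMix_le hrev hl hg (up h hg)).trans (ENNReal.ofReal_le_ofReal hCM)

lemma le_ofReal_mul_of_bounds {C D M : ℝ} (hC : 0 < C) (hD : 0 < D) {a b : ℝ≥0∞}
    (ha : a ≤ ENNReal.ofReal (C * M)) (hb : ENNReal.ofReal (M / D) ≤ b) :
    a ≤ (Real.toNNReal (C * D) : ℝ≥0) * b := by
  calc a ≤ ENNReal.ofReal (C * D * (M / D)) := by
        refine ha.trans (le_of_eq ?_); congr 1; field_simp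
    _ = ENNReal.ofReal (C * D) * ENNReal.ofReal (M / D) := ENNReal.ofReal_mul (by positivity)
    _ ≤ _ := mul_le_mul_right hb _

end MarkovRI

end

theorem theorem1 (Δ : ℕ) (ε r : ℝ) (hε : 0 < ε) :
    ∃ C : ℝ≥0,
      ∀ (V : Type u) [Fintype V] [DecidableEq V] (W : Type v) [Fintype W] [DecidableEq W]
        (P : Matrix V V ℝ) (π : V → ℝ) (Q : Matrix W W ℝ) (ρ : W → ℝ),
        MarkovRI.IsLazyIrreducibleChain P π →
        MarkovRI.IsLazyIrreducibleChain Q ρ →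
        (MarkovRI.chainGraph Q).IsTree →
        MarkovRI.IsUniform ε P π →
        MarkovRI.IsUniform ε Q ρ →
        MarkovRI.maxDeg (MarkovRI.chainGraph P) ≤ Δ →
        MarkovRI.maxDeg (MarkovRI.chainGraph Q) ≤ Δ →
        MarkovRI.RoughlyIsometric r (MarkovRI.chainGraph P) (MarkovRI.chainGraph Q) →
        MarkovRI.ComparableWith C (MarkovRI.tStop P π) (MarkovRI.tStop Q ρ) ∧
        (MarkovRI.IsReversible P π → MarkovRI.IsReversible Q ρ →
          MarkovRI.ComparableWith C (MarkovRI.tMix P π) (MarkovRI.tMix Q ρ)) := by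
  have hK : 0 < 2 * ((Δ : ℝ) + 1) / ε := by positivity
  -- The bounds are needed at two universe levels, for `X` over `T` and for `Y` over its own tree.
  -- The `+ 1` makes the coarse constant admissible for the identity as well.
  obtain ⟨C, hC, hX⟩ := MarkovRI.exists_branchWeight_bounds.{u, v} Δ (⌈2 * |r|⌉₊ + 1) hK
  obtain ⟨D, hD, hY⟩ := MarkovRI.exists_branchWeight_bounds.{v, v} Δ (⌈2 * |r|⌉₊ + 1) hK
  refine ⟨Real.toNNReal (C * D), ?_⟩
  intro V _ _ W _ _ P π Q ρ hP hQ hT hPU hQU hPΔ hQΔ hrough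
  have hGΔ := MarkovRI.degreeLE_of_maxDeg_le hPΔ
  have hTΔ := MarkovRI.degreeLE_of_maxDeg_le hQΔ
  have fP := hP.isUniformFlow hε hPU hGΔ
  have fQ := hQ.isUniformFlow hε hQU hTΔ
  obtain ⟨φ, hφ⟩ := hrough.exists_isCoarse
  obtain ⟨o, ho⟩ := MarkovRI.exists_centroid hT.connected
  obtain ⟨par, hpar⟩ := MarkovRI.exists_rooting hT o
  -- Every descendant of a child `v` of the root is exactly one step farther from `o` than from `v`,
  -- so the branch is a set to which the centroid property applies.
  have hcentre : ∀ v, (MarkovRI.chainGraph Q).Adj o v →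
      2 * (MarkovRI.desc par v).card ≤ Fintype.card W := by
    intro v hv
    have hpv : par v = o := by
      by_contra hcon
      have h1 := hpar.dist_par v hv.ne'
      rw [(SimpleGraph.dist_eq_one_iff_adj).2 hv] at h1
      exact hcon ((hpar.connected.dist_eq_zero_iff).1 (by omega)).symm
    refine ho v hv _ fun w hw => ?_
    have h1 := hpar.dist_add_le hw (hpar.root_notMem_desc hv.ne')
    rw [hpv, SimpleGraph.dist_self] at h1
    have h2 := hpar.connected.dist_triangle (u := o) (v := v) (w := w)
    rw [(SimpleGraph.dist_eq_one_iff_adj).2 hv] at h2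
    rw [SimpleGraph.dist_comm (u := w) (v := v), SimpleGraph.dist_comm (u := w) (v := o)] at h1
    omega
  have := hT.connected.nonempty
  obtain ⟨m, hm⟩ := Finite.exists_max (MarkovRI.branchWeight (MarkovRI.chainGraph Q) o par)
  obtain ⟨x1, x2, x3, x4⟩ := hX fP hGΔ hTΔ hpar (hφ.mono (Nat.le_succ _)) hcentre m hm
  obtain ⟨y1, y2, y3, y4⟩ := hY fQ hTΔ hTΔ hpar
    ((MarkovRI.isCoarse_id _).mono (Nat.le_add_left _ _)) hcentre m hm
  have comm : D * C = C * D := mul_comm _ _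
  refine ⟨⟨MarkovRI.le_ofReal_mul_of_bounds hC hD x1 y2, ?_⟩, fun hPr hQr =>
    ⟨MarkovRI.le_ofReal_mul_of_bounds hC hD (x4 hPr hP.lazy) y3, ?_⟩⟩
  · rw [← comm]; exact MarkovRI.le_ofReal_mul_of_bounds hD hC y1 x2
  · rw [← comm]; exact MarkovRI.le_ofReal_mul_of_bounds hD hC (y4 hQr hQ.lazy) x3
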